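/- Let $K\ge 1$, let $\pi=(\pi_a)_{a\in[K]}$ be a probability vector with all $\pi_a>0$, and let $\kappa=(\kappa_{a,b})_{a,b\in[K]}$ have positive entries. Let $(\mathcal G_n)_{n\ge0}$ be the attributed linear preferential attachment model $\mathscr P(1,\pi,\kappa)$: it starts from a fixed finite connected graph $\mathcal G_0$ whose vertices carry attributes in $[K]$; at each time $n+1$ a vertex $v_{n+1}$ enters whose attribute $a(v_{n+1})$ has law $\pi$ and is independent of the past, and, given the past and $a(v_{n+1})=a^\star$, it is joined by one edge to a vertex $v$ of $\mathcal G_n$ chosen with probability $$\frac{\kappa_{a(v),a^\star}\deg(v,n)}{\sum_{v'\in\mathcal G_n}\kappa_{a(v'),a^\star}\deg(v',n)} .$$ Here $\deg(v,n)$ is the degree of $v$ in $\mathcal G_n$, except that if $\mathcal G_0$ is a single vertex $v_0$, the degree of $v_0$ is initialized to be $1$. The function $V_\pi(y)=1-\frac12\sum_j\pi_j\big(\log y_j+\log\sum_k y_k\kappa_{k,j}\big)$ has a unique minimizer $\eta$ in the open simplex $\{y: y_j>0,\ \sum_j y_j=1\}$. Put $$\nu_b=\frac{\pi_b}{\sum_l\kappa_{l,b}\eta_l},\qquad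 \phi_{a,b}=\kappa_{a,b}\nu_b,\qquad \phi_a=\sum_b\phi_{a,b},\qquad M_{a,b}=\frac{\phi_{a,b}}{2-\phi_a}.$$ (a) For each $a\in[K]$ let $p_n^a(k)$ be the proportion of vertices of degree $k$ among the vertices of type $a$ in $\mathcal G_n$. Almost surely, for all $k\ge1$, $p_n^a(k)\to p_\infty^a(k)$ as $n\to\infty$, where $$p_\infty^a(k)=\frac{2}{\phi_a}\,\frac{\Gamma(1+2/\phi_a)\,\Gamma(k)}{\Gamma(k+1+2/\phi_a)},\qquad k\ge1,$$ is a probability mass function on $\{1,2,\dots\}$. In particular $p_\infty^a(k)\sim \frac{2}{\phi_a}\Gamma(1+2/\phi_a)\,k^{-(1+2/\phi_a)}$ as $k\to\infty$, so that the tail exponent depends on the attribute. (b) Let $\mathcal V_{n,a}$ be the set of vertices of type $a$ in $\mathcal G_n$, $\mathcal E_n$ the edge set of $\mathcal G_n$, $\mathcal E_{n,aa'}$ the set of edges between a vertex of type $a$ and one of type $a'$, $p_n=|\mathcal E_n|/\binom n2$, and $$D_{n,a}=\frac{|\mathcal E_{n,aa}|}{\binom{|\mathcal V_{n,a}|}{2}p_n},\qquad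 H_{n,aa'}=\frac{|\mathcal E_{n,aa'}|}{|\mathcal V_{n,a}||\mathcal V_{n,a'}|p_n}\quad(a\ne a').$$ Then, almost surely as $n\to\infty$, for all $a\in[K]$ and all $a'\neq a$, $$D_{n,a}\to\frac{M_{a,a}}{\pi_a},\qquad H_{n,aa'}\to\frac12\left[\frac{M_{a',a}}{\pi_a}+\frac{M_{a,a'}}{\pi_{a'}}\right].$$ -/

import Mathlib

open MeasureTheory Filter Topology Asymptotics
open scoped BigOperators ENNReal

namespace AttributedPA

noncomputable section

/-- Vertices of the evolving network: `Sum.inl w` is a vertex of the base graph (which has `n₀`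
vertices), and `Sum.inr i` is the newcomer `v_{i+1}`, the vertex that enters at time `i + 1`. -/
abbrev Vertex (n₀ : ℕ) : Type := Fin n₀ ⊕ ℕ

/-- A growth history: `(x i).1` is the attribute of the newcomer `v_{i+1}`, and `(x i).2` is the
vertex to which its single outgoing edge attaches. -/
abbrev History (K n₀ : ℕ) : Type := ℕ → Fin K × Vertex n₀

/-- The vertex set of the network at time `n`: the base vertices and `v_1, …, v_n`. -/
def vertexSet (n₀ n : ℕ) : Finset (Vertex n₀) :=
  (Finset.univ : Finset (Fin n₀)).disjSum (Finset.range n)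

/-- The attribute of a vertex; `a₀` gives the attributes of the base vertices. -/
def attr {K n₀ : ℕ} (a₀ : Fin n₀ → Fin K) (x : History K n₀) : Vertex n₀ → Fin K :=
  Sum.elim a₀ (fun i => (x i).1)

/-- The (undirected) network at time `n`: the edges of the base graph `G₀`, and one edge from each
of the newcomers `v_1, …, v_n` to the vertex it attached to. Its vertex set is `vertexSet n₀ n`;
the vertices that have not yet entered are isolated. -/
def network {K n₀ : ℕ} (G₀ : SimpleGraph (Fin n₀)) (x : History K n₀) (n : ℕ) :
    SimpleGraph (Vertex n₀) :=
  G₀.map Function.Embedding.inl ⊔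
    SimpleGraph.fromEdgeSet {e | ∃ i < n, e = s(Sum.inr i, (x i).2)}

/-- The degree `deg(v, n)`, with the convention that if the base graph is a single vertex then this
vertex starts with degree `1` (so that it always has one more than its number of neighbours). -/
def deg {K n₀ : ℕ} (G₀ : SimpleGraph (Fin n₀)) (x : History K n₀) (n : ℕ) (v : Vertex n₀) : ℕ :=
  ((network G₀ x n).neighborSet v).ncard + if n₀ = 1 ∧ v.isLeft = true then 1 else 0

/-- The probability that the next newcomer, given that its attribute is `b`, attaches to the vertex
`v` of the network at time `n` (linear preferential attachment, one outgoing edge). -/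
def attachProb {K n₀ : ℕ} (κ : Fin K → Fin K → ℝ) (G₀ : SimpleGraph (Fin n₀))
    (a₀ : Fin n₀ → Fin K) (x : History K n₀) (n : ℕ) (b : Fin K) (v : Vertex n₀) : ℝ :=
  κ (attr a₀ x v) b * (deg G₀ x n v : ℝ) /
    ∑ w ∈ vertexSet n₀ n, κ (attr a₀ x w) b * (deg G₀ x n w : ℝ)

/-- `X` is a realization, on the probability space `(Ω, μ)`, of the attributed linear preferential
attachment model started from `(G₀, a₀)`. Since `X 0, …, X (n - 1)` determine the networks at times
`0, …, n` and conversely, conditioning on these networks is conditioning on this finite history. -/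
structure IsModel {K n₀ : ℕ} {Ω : Type*} [MeasurableSpace Ω] (μ : Measure Ω)
    (π : Fin K → ℝ) (κ : Fin K → Fin K → ℝ) (G₀ : SimpleGraph (Fin n₀)) (a₀ : Fin n₀ → Fin K)
    (X : ℕ → Ω → Fin K × Vertex n₀) : Prop where
  measurable : ∀ n, Measurable (X n)
  /-- The attribute of `v_{n+1}` has law `π` and is independent of the past. -/
  attr_law : ∀ (n : ℕ) (h : History K n₀) (b : Fin K),
    μ {ω | (∀ i < n, X i ω = h i) ∧ (X n ω).1 = b} =
      μ {ω | ∀ i < n, X i ω = h i} * ENNReal.ofReal (π b)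
  /-- Given the past and its attribute, `v_{n+1}` attaches to `v` with probability
  `attachProb`. -/
  attach_law : ∀ (n : ℕ) (h : History K n₀) (b : Fin K), ∀ v ∈ vertexSet n₀ n,
    μ {ω | (∀ i < n, X i ω = h i) ∧ (X n ω).1 = b ∧ (X n ω).2 = v} =
      μ {ω | (∀ i < n, X i ω = h i) ∧ (X n ω).1 = b} *
        ENNReal.ofReal (attachProb κ G₀ a₀ h n b v)

/-! ### Empirical statistics of the network at time `n` -/

/-- The vertices of type `a` at time `n`. -/
def typeVertices {K n₀ : ℕ} (a₀ : Fin n₀ → Fin K) (x : History K n₀) (n : ℕ) (a : Fin K) :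
    Finset (Vertex n₀) :=
  (vertexSet n₀ n).filter (fun v => attr a₀ x v = a)

/-- The proportion of vertices of degree `k` among the vertices of type `a` at time `n`. -/
def empDegree {K n₀ : ℕ} (G₀ : SimpleGraph (Fin n₀)) (a₀ : Fin n₀ → Fin K) (x : History K n₀)
    (n : ℕ) (a : Fin K) (k : ℕ) : ℝ :=
  (((typeVertices a₀ x n a).filter (fun v => deg G₀ x n v = k)).card : ℝ) /
    ((typeVertices a₀ x n a).card : ℝ)

/-- The number of edges at time `n` that join a vertex of type `a` and a vertex of type `b`. -/
def numEdges {K n₀ : ℕ} (G₀ : SimpleGraph (Fin n₀)) (a₀ : Fin n₀ → Fin K) (x : History K n₀)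
    (n : ℕ) (a b : Fin K) : ℕ :=
  {e ∈ (network G₀ x n).edgeSet | e.map (attr a₀ x) = s(a, b)}.ncard

/-- The edge density `p_n`. -/
def edgeDensity {K n₀ : ℕ} (G₀ : SimpleGraph (Fin n₀)) (x : History K n₀) (n : ℕ) : ℝ :=
  ((network G₀ x n).edgeSet.ncard : ℝ) / (n.choose 2 : ℝ)

/-- The homophily statistic `D_{n,a}`. -/
def homophily {K n₀ : ℕ} (G₀ : SimpleGraph (Fin n₀)) (a₀ : Fin n₀ → Fin K) (x : History K n₀)
    (n : ℕ) (a : Fin K) : ℝ :=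
  (numEdges G₀ a₀ x n a a : ℝ) /
    (((typeVertices a₀ x n a).card.choose 2 : ℝ) * edgeDensity G₀ x n)

/-- The heterophily statistic `H_{n,ab}` (used for `a ≠ b`). -/
def heterophily {K n₀ : ℕ} (G₀ : SimpleGraph (Fin n₀)) (a₀ : Fin n₀ → Fin K) (x : History K n₀)
    (n : ℕ) (a b : Fin K) : ℝ :=
  (numEdges G₀ a₀ x n a b : ℝ) /
    (((typeVertices a₀ x n a).card : ℝ) * ((typeVertices a₀ x n b).card : ℝ) *
      edgeDensity G₀ x n)

/-! ### The limiting quantities -/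

/-- The interior of the simplex of probability measures on the attribute space. -/
def openSimplex (K : ℕ) : Set (Fin K → ℝ) :=
  {y | (∀ j, 0 < y j) ∧ ∑ j, y j = 1}

/-- The function `V_π` on the interior of the simplex. -/
def V {K : ℕ} (π : Fin K → ℝ) (κ : Fin K → Fin K → ℝ) (y : Fin K → ℝ) : ℝ :=
  1 - (1 / 2) * ∑ j, π j * (Real.log (y j) + Real.log (∑ k, y k * κ k j))

/-- `η` is a minimizer of `V_π` in the interior of the simplex. -/
def IsMinimizer {K : ℕ} (π : Fin K → ℝ) (κ : Fin K → Fin K → ℝ) (η : Fin K → ℝ) : Prop :=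
  η ∈ openSimplex K ∧ IsMinOn (V π κ) (openSimplex K) η

/-- `ν_b`. -/
def nu {K : ℕ} (π : Fin K → ℝ) (κ : Fin K → Fin K → ℝ) (η : Fin K → ℝ) (b : Fin K) : ℝ :=
  π b / ∑ l, κ l b * η l

/-- `φ_{a,b}`. -/
def phi₂ {K : ℕ} (π : Fin K → ℝ) (κ : Fin K → Fin K → ℝ) (η : Fin K → ℝ) (a b : Fin K) : ℝ :=
  κ a b * nu π κ η b

/-- `φ_a`. -/
def phi {K : ℕ} (π : Fin K → ℝ) (κ : Fin K → Fin K → ℝ) (η : Fin K → ℝ) (a : Fin K) : ℝ :=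
  ∑ b, phi₂ π κ η a b

/-- The matrix `M`. -/
def meanMatrix {K : ℕ} (π : Fin K → ℝ) (κ : Fin K → Fin K → ℝ) (η : Fin K → ℝ) :
    Matrix (Fin K) (Fin K) ℝ :=
  Matrix.of fun a b => phi₂ π κ η a b / (2 - phi π κ η a)

/-- The limiting degree distribution with parameter `φ`, at `k ≥ 1`. -/
def limitDegree (φ : ℝ) (k : ℕ) : ℝ :=
  (2 / φ) * (Real.Gamma (1 + 2 / φ) * Real.Gamma (k : ℝ) / Real.Gamma ((k : ℝ) + 1 + 2 / φ))

end

end AttributedPA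

/-! The degree totals of the types form a stochastic approximation scheme. Each growth step adds 2
to the total degree, so the proportions `y_j` of degree held by the types move by steps of order
`1/n` with mean drift proportional to `π_j + y_j Φ_j(y) - 2 y_j`, where `Φ` is `rate`. At the
minimizer `η` of `V`, stationarity on the simplex reads `π_j / η_j + φ_j = 2`
(`IsMinimizer.critical`), so the drift vanishes there.

The Lyapunov function is the relative entropy `-∑ η_j log y_j`. Stationarity makes the `π`-averages
of the ratios `y_j / η_j` and `∑ κ_{l,b} y_l / ∑ κ_{l,b} η_l` add up to 2 (`sum_ratio_eq_two`).
Combined with `u/v ≥ 2 - v/u`, this forces the entropy to decrease at a rate at least `∑ π_j (y_j -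
η_j)²`, up to normalisation (`sum_sq_le_entropy_drift`); combined with `log t ≤ t - 1`, it shows
that a critical point is the unique minimizer (`V_lt_of_critical`). The noise is a series of bounded
centred increments with weights `1/(n+1)`, an `L²`-bounded martingale, hence almost surely
convergent (`ae_tendsto_sum_centered`). Then `robbins_siegmund` makes the entropy converge and its
dissipation small along a subsequence. There `y → η`, which identifies the limit of the entropy, and
the Hellinger bound turns its convergence into `y → η` along the whole sequence
(`tendsto_degree_proportion`).

Once the degree of type `j` is known to grow like `2 η_j n`, every other count `A` has conditional
mean increment `β_n - γ_n A_n / n` with `β_n → b` and `γ_n → c`, and `HasTransition.ae_tendsto_div`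
gives `A_n / n → b / (1 + c)`. For vertices of type `a` and degree `k + 1`, `c = (k + 1) φ_a / 2`
and `b` involves the limit for degree `k`; induction on `k` produces the recursion solved by the
Gamma quotient. For edge counts `c = 0`, and `2 - φ_a = π_a / η_a` rewrites `b` through `M`. -/

namespace AttributedPA

/-! ### Deterministic recursions -/

/-- A deterministic Robbins–Siegmund lemma with steps `1 / (n + 1)`. -/
theorem robbins_siegmund {L g ε : ℕ → ℝ} {B s : ℝ}
    (hL : ∀ᶠ n in atTop, B ≤ L n) (hg : ∀ᶠ n in atTop, 0 ≤ g n)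
    (hε : Tendsto (fun n => ∑ i ∈ Finset.range n, ε i) atTop (𝓝 s))
    (h : ∀ᶠ n : ℕ in atTop, L (n + 1) ≤ L n - g n / (n + 1) + ε n) :
    (∃ l, Tendsto L atTop (𝓝 l)) ∧ ∀ δ > 0, ∃ᶠ n in atTop, g n < δ := by
  -- Removing the convergent noise leaves a sequence that is eventually nonincreasing and bounded
  -- below.
  set U : ℕ → ℝ := fun n => L n - ∑ i ∈ Finset.range n, ε i with hU
  have hstep : ∀ᶠ n : ℕ in atTop, U (n + 1) ≤ U n - g n / (n + 1) := by
    filter_upwards [h] with n hn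
    simp only [hU, Finset.sum_range_succ]
    linarith
  have hbdd : ∀ᶠ n in atTop, B - s - 1 ≤ U n := by
    filter_upwards [hL, hε.eventually (eventually_lt_nhds (show s < s + 1 by linarith))] with n h1 h2
    simp only [hU]
    linarith
  obtain ⟨N, hN⟩ := eventually_atTop.1 (hstep.and (hbdd.and hg))
  have hanti : Antitone fun n => U (n + N) := by
    refine antitone_nat_of_succ_le fun n => ?_
    obtain ⟨h1, -, h3⟩ := hN (n + N) (by omega)
    have : 0 ≤ g (n + N) / (((n + N : ℕ) : ℝ) + 1) := by positivity
    rw [show n + 1 + N = n + N + 1 by ring]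
    linarith
  have hconv : Tendsto U atTop (𝓝 (⨅ n, U (n + N))) := by
    refine (tendsto_add_atTop_iff_nat N).1 (tendsto_atTop_ciInf hanti ⟨B - s - 1, ?_⟩)
    rintro _ ⟨n, rfl⟩
    exact (hN (n + N) (by omega)).2.1
  refine ⟨⟨_, (hconv.add hε).congr fun n => by simp [hU]⟩, fun δ hδ hcon => ?_⟩
  obtain ⟨N', hN'⟩ := eventually_atTop.1 hcon
  set m := max N N'
  -- If `g` stayed above `δ`, the harmonic series would drive `U` to `-∞`.
  have hdec : ∀ n, U (m + n) ≤ U m - δ * ∑ i ∈ Finset.range n, (1 / ((i : ℝ) + (m + 1))) := by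
    intro n
    induction n with
    | zero => simp
    | succ n ih =>
      have h1 := (hN (m + n) (by omega)).1
      have h2 : δ ≤ g (m + n) := not_lt.1 (hN' (m + n) (by omega))
      have h3 : δ * (1 / ((n : ℝ) + (m + 1))) ≤ g (m + n) / (((m + n : ℕ) : ℝ) + 1) := by
        rw [mul_one_div, show (((m + n : ℕ) : ℝ) + 1) = (n : ℝ) + (m + 1) by push_cast; ring]
        gcongr
      rw [Finset.sum_range_succ, mul_add, ← add_assoc]
      linarith
  have hdiv : Tendsto (fun n => ∑ i ∈ Finset.range n, (1 / ((i : ℝ) + (m + 1)))) atTop atTop := by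
    have h0 := Real.tendsto_sum_range_one_div_nat_succ_atTop
    have h1 := (tendsto_add_atTop_iff_nat m).2 h0
    refine (tendsto_atTop_add_const_right _
      (-∑ i ∈ Finset.range m, (1 / ((i : ℝ) + 1))) h1).congr fun n => ?_
    rw [add_comm n m, Finset.sum_range_add]
    simp only [add_neg_cancel_comm]
    refine Finset.sum_congr rfl fun i _ => ?_
    push_cast
    ring_nf
  obtain ⟨n, hn⟩ := (hdiv.eventually_gt_atTop ((U m - (B - s - 1)) / δ)).exists
  have := (hN (m + n) (by omega)).2.1
  rw [div_lt_iff₀ hδ] at hn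
  linarith [hdec n]

/-- Passing to the excess `max (w n - δ) 0` absorbs the vanishing forcing: eventually `γ n ≤ α n *
δ`, so the excess obeys a homogeneous recursion with dissipation `a / 2` times itself.
`robbins_siegmund` applies without noise, and its limit must be zero because the dissipation is
frequently small. -/
theorem tendsto_zero_of_contraction {w α γ : ℕ → ℝ} {a : ℝ} (ha : 0 < a)
    (hα : Tendsto α atTop (𝓝 a)) (hγ : Tendsto γ atTop (𝓝 0)) (hw : ∀ n, 0 ≤ w n)
    (h : ∀ᶠ n : ℕ in atTop, w (n + 1) ≤ (1 - α n / (n + 1)) * w n + γ n / (n + 1)) :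
    Tendsto w atTop (𝓝 0) := by
  have key : ∀ δ > 0, Tendsto (fun n => max (w n - δ) 0) atTop (𝓝 0) := by
    intro δ hδ
    have hstep : ∀ᶠ n : ℕ in atTop, max (w (n + 1) - δ) 0 ≤
        max (w n - δ) 0 - (a / 2 * max (w n - δ) 0) / (n + 1) + 0 := by
      have e1 := hα.eventually (eventually_gt_nhds (show a / 2 < a by linarith))
      have e2 := hγ.eventually (eventually_lt_nhds (show 0 < a / 2 * δ by positivity))
      have e3 : ∀ᶠ n : ℕ in atTop, α n ≤ (n : ℝ) + 1 := by
        filter_upwards [hα.eventually (eventually_lt_nhds (show a < a + 1 by linarith)),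
          tendsto_natCast_atTop_atTop.eventually_ge_atTop (a + 1)] with n h1 h2
        linarith
      filter_upwards [h, e1, e2, e3] with n h0 h1 h2 h3
      have hn : (0 : ℝ) < n + 1 := by positivity
      have hc : 0 ≤ 1 - α n / (n + 1) := by
        rw [sub_nonneg, div_le_one hn]; exact h3
      have hu : 0 ≤ max (w n - δ) 0 := le_max_right _ _
      have h4 : (1 - α n / (n + 1)) * max (w n - δ) 0 ≤
          max (w n - δ) 0 - (a / 2 * max (w n - δ) 0) / (n + 1) + 0 := by
        have : a / 2 * max (w n - δ) 0 / (n + 1) ≤ α n * max (w n - δ) 0 / (n + 1) := by gcongr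
        calc _ = max (w n - δ) 0 - α n * max (w n - δ) 0 / (n + 1) := by ring
          _ ≤ _ := by linarith
      refine max_le ?_ (le_trans (by positivity) h4)
      refine le_trans ?_ h4
      have h5 : (1 - α n / (n + 1)) * (w n - δ) ≤ (1 - α n / (n + 1)) * max (w n - δ) 0 := by
        gcongr; exact le_max_left _ _
      have h6 : γ n / (n + 1) ≤ α n * δ / (n + 1) := by
        gcongr
        exact h2.le.trans (by gcongr)
      calc w (n + 1) - δ ≤ (1 - α n / (n + 1)) * w n + γ n / (n + 1) - δ := by linarith
        _ = (1 - α n / (n + 1)) * (w n - δ) + (γ n / (n + 1) - α n * δ / (n + 1)) := by ring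
        _ ≤ _ := by linarith
    obtain ⟨⟨l, hl⟩, hfr⟩ := robbins_siegmund (B := 0) (s := 0) (ε := fun _ => 0)
      (Eventually.of_forall fun n => le_max_right (w n - δ) 0)
      (Eventually.of_forall fun n => by positivity) (by simp) hstep
    have hl0 : l = 0 := by
      refine le_antisymm (le_of_forall_pos_le_add fun η hη => ?_)
        (ge_of_tendsto' hl fun n => le_max_right _ _)
      by_contra hcon
      push Not at hcon
      refine hfr (a / 2 * η) (by positivity) ?_
      filter_upwards [hl.eventually (eventually_gt_nhds (show η < l by linarith))] with n hn
      rw [not_lt]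
      gcongr
    rwa [hl0] at hl
  rw [Metric.tendsto_atTop']
  intro δ hδ
  obtain ⟨N, hN⟩ := eventually_atTop.1
    ((key (δ / 2) (by positivity)).eventually (eventually_lt_nhds (show 0 < δ / 2 by positivity)))
  refine ⟨N, fun n hn => ?_⟩
  have := (le_max_left _ _).trans_lt (hN n hn.le)
  rw [Real.dist_eq, sub_zero, abs_of_nonneg (hw n)]
  linarith

/-- Convergence of a Robbins–Monro recursion with an asymptotically affine drift and steps
`1 / (n + 1)`. -/
theorem tendsto_of_affine_recursion {x α β ε : ℕ → ℝ} {a b s : ℝ} (ha : 0 < a)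
    (hα : Tendsto α atTop (𝓝 a)) (hβ : Tendsto β atTop (𝓝 b))
    (hε : Tendsto (fun n => ∑ i ∈ Finset.range n, ε i) atTop (𝓝 s))
    (h : ∀ᶠ n : ℕ in atTop, x (n + 1) = x n + (β n - α n * x n) / (n + 1) + ε n) :
    Tendsto x atTop (𝓝 (b / a)) := by
  -- Minus the tail of the noise series. Subtracting it from `x` turns summable noise, which need
  -- not be small compared with `1 / (n + 1)`, into a vanishing perturbation of the drift.
  set e : ℕ → ℝ := fun n => ∑ i ∈ Finset.range n, ε i - s with he
  have he0 : Tendsto e atTop (𝓝 0) := by simpa using hε.sub_const s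
  set w : ℕ → ℝ := fun n => x n - e n - b / a with hw
  set γ : ℕ → ℝ := fun n => |β n - α n * (e n + b / a)| with hγ
  have hγ0 : Tendsto γ atTop (𝓝 0) := by
    have : Tendsto (fun n => β n - α n * (e n + b / a)) atTop (𝓝 (b - a * (0 + b / a))) :=
      hβ.sub (hα.mul (he0.add_const _))
    rw [zero_add, mul_div_cancel₀ _ ha.ne', sub_self] at this
    simpa using this.abs
  have hlim : Tendsto (fun n => |w n|) atTop (𝓝 0) := by
    refine tendsto_zero_of_contraction ha hα hγ0 (fun n => abs_nonneg _) ?_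
    filter_upwards [h, hα.eventually (eventually_lt_nhds (show a < a + 1 by linarith)),
      tendsto_natCast_atTop_atTop.eventually_ge_atTop (a + 1)] with n hn h1 h2
    have hn0 : (0 : ℝ) < n + 1 := by positivity
    have hc : 0 ≤ 1 - α n / (n + 1) := by
      rw [sub_nonneg, div_le_one hn0]; linarith
    have : w (n + 1) = (1 - α n / (n + 1)) * w n + (β n - α n * (e n + b / a)) / (n + 1) := by
      simp only [hw, he, hn, Finset.sum_range_succ]
      ring
    rw [this]
    refine (abs_add_le _ _).trans ?_
    rw [abs_mul, abs_of_nonneg hc, abs_div, abs_of_pos hn0]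
  have hw0 : Tendsto w atTop (𝓝 0) := (tendsto_zero_iff_abs_tendsto_zero _).2 hlim
  have := (hw0.add he0).add_const (b / a)
  simp only [add_zero, zero_add] at this
  exact this.congr fun n => by simp only [hw]; ring

/-! ### The limiting degree distribution -/

theorem limitDegree_one {φ : ℝ} (hφ : 0 < φ) : limitDegree φ 1 = 1 / (1 + φ / 2) := by
  have h2 : 0 < 1 + 2 / φ := by positivity
  have hG := Real.Gamma_add_one h2.ne'
  have hpos := Real.Gamma_pos_of_pos h2
  rw [limitDegree, show ((1 : ℕ) : ℝ) + 1 + 2 / φ = (1 + 2 / φ) + 1 by push_cast; ring, hG]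
  simp only [Nat.cast_one, Real.Gamma_one]
  field_simp
  ring

/-- This is the recursion that the limiting frequencies are found to satisfy in
`ae_tendsto_degCount`; together with the value at 1 it identifies them. -/
theorem limitDegree_succ {φ : ℝ} (hφ : 0 < φ) {k : ℕ} (hk : 1 ≤ k) :
    limitDegree φ (k + 1) = φ / 2 * k * limitDegree φ k / (1 + (k + 1) * (φ / 2)) := by
  have hk0 : (0 : ℝ) < k := by exact_mod_cast hk
  have h1 : 0 < (k : ℝ) + 1 + 2 / φ := by positivity
  have hG := Real.Gamma_add_one h1.ne'
  have hpos := Real.Gamma_pos_of_pos h1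
  rw [limitDegree, limitDegree, show ((k + 1 : ℕ) : ℝ) + 1 + 2 / φ = ((k : ℝ) + 1 + 2 / φ) + 1 by
    push_cast; ring, hG, Nat.cast_succ, Real.Gamma_add_one hk0.ne']
  field_simp
  ring

/-- Euler's limit formula for `Γ(1 + s)`. Its product of `k + 1` factors is `Γ(k + 2 + s) / Γ(1 +
s)`, one factor `k + 1 + s` too many; `hfac` compensates for this. -/
theorem tendsto_Gamma_ratio {s : ℝ} (hs : 0 < s) :
    Tendsto (fun k : ℕ => (k : ℝ) ^ (1 + s) * (Real.Gamma k / Real.Gamma ((k : ℝ) + 1 + s)))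
      atTop (𝓝 1) := by
  have h1s : 0 < 1 + s := by positivity
  have hprod : ∀ n : ℕ, (∏ j ∈ Finset.range n, (1 + s + (j : ℝ))) * Real.Gamma (1 + s) =
      Real.Gamma (1 + s + n) := by
    intro n
    induction n with
    | zero => simp
    | succ n ih =>
      rw [Finset.prod_range_succ, mul_right_comm, ih, Nat.cast_succ, ← add_assoc,
        Real.Gamma_add_one (by positivity), mul_comm]
  have hseq := (Real.GammaSeq_tendsto_Gamma (1 + s)).div_const (Real.Gamma (1 + s))
  have hpos := Real.Gamma_pos_of_pos h1s
  rw [div_self hpos.ne'] at hseq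
  have hfac : Tendsto (fun k : ℕ => 1 + (1 + s) * (1 / (k : ℝ))) atTop (𝓝 1) := by
    simpa using (tendsto_one_div_atTop_nhds_zero_nat.const_mul (1 + s)).const_add 1
  have := hseq.mul hfac
  rw [one_mul] at this
  refine this.congr' ?_
  filter_upwards [eventually_ge_atTop 1] with k hk
  have hk0 : (0 : ℝ) < k := by exact_mod_cast hk
  have hne : 0 < (k : ℝ) + 1 + s := by positivity
  have hGk : Real.Gamma (1 + s + ((k + 1 : ℕ) : ℝ)) =
      ((k : ℝ) + 1 + s) * Real.Gamma ((k : ℝ) + 1 + s) := by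
    rw [← Real.Gamma_add_one hne.ne']
    congr 1
    push_cast
    ring
  have hGpos := Real.Gamma_pos_of_pos hne
  have hfact : (k.factorial : ℝ) = k * Real.Gamma k := by
    rw [← Real.Gamma_nat_eq_factorial, Real.Gamma_add_one hk0.ne']
  rw [Real.GammaSeq, div_div, hprod, hGk, hfact]
  field_simp
  ring

theorem hasSum_limitDegree {φ : ℝ} (hφ : 0 < φ) :
    HasSum (fun k : ℕ => limitDegree φ (k + 1)) 1 := by
  set s := 2 / φ with hs_def
  have hs : 0 < s := by positivity
  have h1s : 0 < 1 + s := by positivity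
  have hpos := Real.Gamma_pos_of_pos h1s
  -- The tail mass beyond `k`: it equals 1 at 0 and its successive differences are the masses, so
  -- the sum telescopes.
  set q : ℕ → ℝ := fun k => Real.Gamma (1 + s) * Real.Gamma ((k : ℝ) + 1) /
    Real.Gamma ((k : ℝ) + 1 + s) with hq
  have hp0 : ∀ k : ℕ, 0 ≤ limitDegree φ (k + 1) := by
    intro k
    have h1 : 0 < ((k + 1 : ℕ) : ℝ) := by positivity
    have h2 : 0 < ((k + 1 : ℕ) : ℝ) + 1 + 2 / φ := by positivity
    have := Real.Gamma_pos_of_pos h1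
    have := Real.Gamma_pos_of_pos h2
    unfold limitDegree
    positivity
  have hdiff : ∀ k, limitDegree φ (k + 1) = q k - q (k + 1) := by
    intro k
    have hk1 : (0 : ℝ) < (k : ℝ) + 1 := by positivity
    have hk2 : (0 : ℝ) < (k : ℝ) + 1 + s := by positivity
    have h2 := Real.Gamma_pos_of_pos hk2
    have hG := Real.Gamma_add_one hk2.ne'
    have hG1 := Real.Gamma_add_one hk1.ne'
    simp only [hq, limitDegree, Nat.cast_succ, ← hs_def]
    rw [hG1, show (k : ℝ) + 1 + 1 + s = (k : ℝ) + 1 + s + 1 by ring, hG]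
    field_simp
    ring
  rw [hasSum_iff_tendsto_nat_of_nonneg hp0]
  have hsum : ∀ n, ∑ i ∈ Finset.range n, limitDegree φ (i + 1) = 1 - q n := by
    intro n
    rw [Finset.sum_congr rfl fun i _ => hdiff i, Finset.sum_range_sub']
    simp only [hq, Nat.cast_zero, zero_add, Real.Gamma_one, mul_one]
    rw [div_self hpos.ne']
  simp_rw [hsum]
  suffices h : Tendsto q atTop (𝓝 0) by simpa using h.const_sub 1
  have hr : Tendsto (fun k : ℕ => (k : ℝ) ^ (-s)) atTop (𝓝 0) :=
    (tendsto_rpow_neg_atTop hs).comp tendsto_natCast_atTop_atTop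
  have := ((tendsto_Gamma_ratio hs).mul hr).const_mul (Real.Gamma (1 + s))
  rw [one_mul, mul_zero] at this
  refine this.congr' ?_
  filter_upwards [eventually_ge_atTop 1] with k hk
  have hk0 : (0 : ℝ) < k := by exact_mod_cast hk
  simp only [hq]
  rw [Real.Gamma_add_one hk0.ne', Real.rpow_add hk0, Real.rpow_one, Real.rpow_neg hk0.le]
  have : (k : ℝ) ^ s ≠ 0 := (Real.rpow_pos_of_pos hk0 s).ne'
  field_simp

theorem limitDegree_isEquivalent {φ : ℝ} (hφ : 0 < φ) :
    (fun k : ℕ => limitDegree φ k) ~[atTop]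
      (fun k : ℕ => (2 / φ) * Real.Gamma (1 + 2 / φ) * (k : ℝ) ^ (-(1 + 2 / φ))) := by
  have hs : 0 < 2 / φ := by positivity
  have hpos := Real.Gamma_pos_of_pos (show 0 < 1 + 2 / φ by positivity)
  refine (isEquivalent_iff_tendsto_one ?_).2 ((tendsto_Gamma_ratio hs).congr' ?_)
  · filter_upwards [eventually_ge_atTop 1] with k hk
    have hk0 : (0 : ℝ) < k := by exact_mod_cast hk
    positivity
  · filter_upwards [eventually_ge_atTop 1] with k hk
    have hk0 : (0 : ℝ) < k := by exact_mod_cast hk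
    simp only [Pi.div_apply, limitDegree]
    rw [Real.rpow_neg hk0.le]
    have := Real.rpow_pos_of_pos hk0 (1 + 2 / φ)
    field_simp

/-! ### The minimizer of `V` -/

section Minimizer

variable {K : ℕ} {π : Fin K → ℝ} {κ : Fin K → Fin K → ℝ}

theorem nonempty_fin_of_sum_eq_one (hπ_sum : ∑ a, π a = 1) : Nonempty (Fin K) := by
  by_contra h
  rw [not_nonempty_iff] at h
  simp at hπ_sum

theorem sum_mul_pos {y : Fin K → ℝ} [Nonempty (Fin K)] (hκ : ∀ a b, 0 < κ a b)
    (hy : ∀ j, 0 < y j) (b : Fin K) : 0 < ∑ l, κ l b * y l :=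
  Finset.sum_pos (fun l _ => mul_pos (hκ l b) (hy l)) Finset.univ_nonempty

/-- `Φ_j(y)`, the normalised rate at which a unit of degree of type `j` attracts edges when the
degree proportions are `y`. -/
noncomputable def rate (π : Fin K → ℝ) (κ : Fin K → Fin K → ℝ) (y : Fin K → ℝ) (j : Fin K) : ℝ :=
  ∑ b, π b * κ j b / ∑ l, κ l b * y l

theorem phi_eq_rate (η : Fin K → ℝ) (a : Fin K) : phi π κ η a = rate π κ η a := by
  simp only [phi, phi₂, nu, rate]
  exact Finset.sum_congr rfl fun b _ => by ring

theorem rate_pos [Nonempty (Fin K)] (hπ : ∀ a, 0 < π a) (hκ : ∀ a b, 0 < κ a b)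
    {y : Fin K → ℝ} (hy : ∀ j, 0 < y j) (j : Fin K) : 0 < rate π κ y j :=
  Finset.sum_pos (fun b _ => div_pos (mul_pos (hπ b) (hκ j b)) (sum_mul_pos hκ hy b))
    Finset.univ_nonempty

/-- The right-hand side extends continuously to the closed simplex and vanishes on its boundary, so
minimizing `V` becomes a compactness argument. -/
theorem exp_V [Nonempty (Fin K)] (hκ : ∀ a b, 0 < κ a b) {y : Fin K → ℝ} (hy : ∀ j, 0 < y j) :
    Real.exp (2 * (1 - V π κ y)) = ∏ j, (y j * ∑ l, κ l j * y l) ^ π j := by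
  have h : 2 * (1 - V π κ y) = ∑ j, Real.log (y j * ∑ l, κ l j * y l) * π j := by
    rw [V]
    have : ∀ j, Real.log (y j * ∑ l, κ l j * y l) * π j =
        π j * (Real.log (y j) + Real.log (∑ k, y k * κ k j)) := fun j => by
      rw [Real.log_mul (hy j).ne' (sum_mul_pos hκ hy j).ne', mul_comm]
      simp only [mul_comm]
    rw [Finset.sum_congr rfl fun j _ => this j]
    ring
  rw [h, Real.exp_sum]
  exact Finset.prod_congr rfl fun j _ =>
    (Real.rpow_def_of_pos (mul_pos (hy j) (sum_mul_pos hκ hy j)) _).symm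

theorem exists_isMinimizer (hπ : ∀ a, 0 < π a) (hπ_sum : ∑ a, π a = 1)
    (hκ : ∀ a b, 0 < κ a b) : ∃ η, IsMinimizer π κ η := by
  have := nonempty_fin_of_sum_eq_one hπ_sum
  set F : (Fin K → ℝ) → ℝ := fun y => ∏ j, (y j * ∑ l, κ l j * y l) ^ π j with hF
  have hcont : Continuous F := by
    refine continuous_finsetProd _ fun j _ => ?_
    refine Continuous.rpow_const ?_ fun _ => Or.inr (hπ j).le
    fun_prop
  obtain ⟨η, hη, hmax⟩ := (isCompact_stdSimplex ℝ (Fin K)).exists_isMaxOn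
    ⟨π, fun a => (hπ a).le, hπ_sum⟩ hcont.continuousOn
  have hFη : 0 < F η := lt_of_lt_of_le
    (Finset.prod_pos fun j _ => Real.rpow_pos_of_pos (mul_pos (hπ j) (sum_mul_pos hκ hπ j)) _)
    (hmax (show π ∈ stdSimplex ℝ (Fin K) from ⟨fun a => (hπ a).le, hπ_sum⟩))
  have hpos : ∀ j, 0 < η j := by
    intro j
    refine lt_of_le_of_ne (hη.1 j) fun h0 => hFη.ne' ?_
    refine Finset.prod_eq_zero (Finset.mem_univ j) ?_
    rw [← h0, zero_mul, Real.zero_rpow (hπ j).ne']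
  refine ⟨η, ⟨hpos, hη.2⟩, fun y hy => ?_⟩
  have h1 : F y ≤ F η := hmax (show y ∈ stdSimplex ℝ (Fin K) from ⟨fun j => (hy.1 j).le, hy.2⟩)
  simp only [hF] at h1
  rw [← exp_V hκ hy.1, ← exp_V hκ hpos, Real.exp_le_exp] at h1
  show V π κ η ≤ V π κ y
  linarith

theorem IsMinimizer.critical [Nonempty (Fin K)] (hκ : ∀ a b, 0 < κ a b)
    (hπ_sum : ∑ a, π a = 1) {η : Fin K → ℝ} (h : IsMinimizer π κ η) (j : Fin K) :
    π j / η j + phi π κ η j = 2 := by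
  obtain ⟨⟨hpos, hsum⟩, hmin⟩ := h
  -- The direction from `η` to the `j`-th vertex of the simplex. Its entries sum to zero, so no
  -- Lagrange multiplier is needed, and the two parts of the derivative become `π_j / η_j - 1` and
  -- `φ_j - 1`.
  set d : Fin K → ℝ := fun i => (if i = j then 1 else 0) - η i with hd
  have hdsum : ∑ i, d i = 0 := by simp [hd, hsum]
  set y : ℝ → Fin K → ℝ := fun t i => η i + t * d i with hy
  have hmem : ∀ᶠ t in 𝓝 (0 : ℝ), y t ∈ openSimplex K := by
    have h1 : ∀ i, ∀ᶠ t in 𝓝 (0 : ℝ), 0 < y t i := by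
      intro i
      have : ContinuousAt (fun t => y t i) 0 := by simp only [hy]; fun_prop
      exact this.eventually (lt_mem_nhds (by simpa [hy] using hpos i))
    filter_upwards [eventually_all.2 h1] with t ht
    refine ⟨ht, ?_⟩
    simp only [hy, Finset.sum_add_distrib, ← Finset.mul_sum, hdsum, hsum]
    ring
  have hloc : IsLocalMin (fun t => V π κ (y t)) 0 := by
    filter_upwards [hmem] with t ht
    have : y 0 = η := by funext i; simp [hy]
    rw [this]
    exact hmin ht
  have hyd : ∀ i, HasDerivAt (fun t => y t i) (d i) 0 := fun i => by
    simpa [hy] using ((hasDerivAt_id (0 : ℝ)).mul_const (d i)).const_add (η i)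
  have hz : ∀ b, HasDerivAt (fun t => ∑ k, y t k * κ k b) (∑ k, d k * κ k b) 0 := fun b =>
    HasDerivAt.fun_sum fun k _ => (hyd k).mul_const _
  have hy0 : ∀ i, y 0 i = η i := fun i => by simp [hy]
  have hz0 : ∀ b, 0 < ∑ k, η k * κ k b := fun b => by
    simpa only [mul_comm] using sum_mul_pos hκ hpos b
  have hder : HasDerivAt (fun t => V π κ (y t))
      (-(1 / 2 * ∑ b, π b * (d b / η b + (∑ k, d k * κ k b) / ∑ k, η k * κ k b))) 0 := by
    simp only [V]
    refine HasDerivAt.const_sub _ (HasDerivAt.const_mul _ (HasDerivAt.fun_sum fun b _ => ?_))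
    refine HasDerivAt.const_mul _ (HasDerivAt.add ?_ ?_)
    · simpa only [hy0] using (hyd b).log (by rw [hy0]; exact (hpos b).ne')
    · simpa only [hy0] using (hz b).log (by simp only [hy0]; exact (hz0 b).ne')
  have h0 := hloc.hasDerivAt_eq_zero hder
  have e1 : ∑ b, π b * (d b / η b) = π j / η j - 1 := by
    have : ∀ b, π b * (d b / η b) = (if b = j then π b / η b else 0) - π b := fun b => by
      have := (hpos b).ne'
      simp only [hd]
      split_ifs
      · field_simp
      · field_simp
        ring
    rw [Finset.sum_congr rfl fun b _ => this b, Finset.sum_sub_distrib, hπ_sum]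
    simp
  have e2 : ∑ b, π b * ((∑ k, d k * κ k b) / ∑ k, η k * κ k b) = phi π κ η j - 1 := by
    have : ∀ b, π b * ((∑ k, d k * κ k b) / ∑ k, η k * κ k b) =
        π b * κ j b / (∑ l, κ l b * η l) - π b := fun b => by
      have hne := (hz0 b).ne'
      have hn : ∑ k, d k * κ k b = κ j b - ∑ k, η k * κ k b := by
        simp [hd, sub_mul, Finset.sum_sub_distrib]
      have hc : ∑ l, κ l b * η l = ∑ k, η k * κ k b := by simp only [mul_comm]
      rw [hn, hc]
      field_simp
    rw [Finset.sum_congr rfl fun b _ => this b, Finset.sum_sub_distrib, hπ_sum, phi_eq_rate, rate]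
  simp only [mul_add, Finset.sum_add_distrib] at h0
  rw [e1, e2] at h0
  linarith

/-- If `η` is critical, then the ratios `y_j / η_j` and `∑ κ_{l,b} y_l / ∑ κ_{l,b} η_l` have
`π`-averages adding up to `2`, for every `y` in the simplex. -/
theorem sum_ratio_eq_two {η y : Fin K → ℝ} (hcrit : ∀ j, π j / η j + phi π κ η j = 2)
    (hy : ∑ j, y j = 1) :
    ∑ j, π j * (y j / η j) + ∑ b, π b * ((∑ l, κ l b * y l) / ∑ l, κ l b * η l) = 2 := by
  have h2 : ∑ b, π b * ((∑ l, κ l b * y l) / ∑ l, κ l b * η l) = ∑ l, y l * phi π κ η l := by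
    simp only [phi_eq_rate, rate, Finset.mul_sum, Finset.sum_div]
    rw [Finset.sum_comm]
    exact Finset.sum_congr rfl fun l _ => Finset.sum_congr rfl fun b _ => by ring
  rw [h2, ← Finset.sum_add_distrib]
  calc ∑ j, (π j * (y j / η j) + y j * phi π κ η j)
      = ∑ j, y j * (π j / η j + phi π κ η j) := Finset.sum_congr rfl fun j _ => by ring
    _ = 2 := by simp only [hcrit, ← Finset.sum_mul, hy, one_mul]

/-- Applying `log t ≤ t - 1` to all ratios bounds `V π κ η - V π κ y` by half of `2 - 2`. Strictness
comes from the coordinate ratios `y_j / η_j`, not all of which are 1. -/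
theorem V_lt_of_critical [Nonempty (Fin K)] (hπ : ∀ a, 0 < π a) (hπ_sum : ∑ a, π a = 1)
    (hκ : ∀ a b, 0 < κ a b) {η y : Fin K → ℝ} (hη : η ∈ openSimplex K)
    (hcrit : ∀ j, π j / η j + phi π κ η j = 2) (hy : y ∈ openSimplex K) (hne : y ≠ η) :
    V π κ η < V π κ y := by
  have hr := sum_ratio_eq_two hcrit hy.2
  have hcomm : ∀ (z : Fin K → ℝ) b, ∑ k, z k * κ k b = ∑ l, κ l b * z l := fun z b =>
    Finset.sum_congr rfl fun _ _ => mul_comm _ _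
  have h1 : V π κ η - V π κ y = 1 / 2 * (∑ j, π j * Real.log (y j / η j) +
      ∑ b, π b * Real.log ((∑ l, κ l b * y l) / ∑ l, κ l b * η l)) := by
    simp only [V, hcomm]
    rw [sub_sub_sub_cancel_left, ← mul_sub, ← Finset.sum_sub_distrib, ← Finset.sum_add_distrib]
    congr 1
    refine Finset.sum_congr rfl fun j _ => ?_
    rw [Real.log_div (hy.1 j).ne' (hη.1 j).ne',
      Real.log_div (sum_mul_pos hκ hy.1 j).ne' (sum_mul_pos hκ hη.1 j).ne']
    ring
  have h2 : ∑ j, π j * Real.log (y j / η j) < ∑ j, π j * (y j / η j - 1) := by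
    obtain ⟨i, hi⟩ := Function.ne_iff.1 hne
    refine Finset.sum_lt_sum (fun j _ => ?_) ⟨i, Finset.mem_univ _, ?_⟩
    · exact mul_le_mul_of_nonneg_left
        (Real.log_le_sub_one_of_pos (div_pos (hy.1 j) (hη.1 j))) (hπ j).le
    · refine mul_lt_mul_of_pos_left
        (Real.log_lt_sub_one_of_pos (div_pos (hy.1 i) (hη.1 i)) fun h => hi ?_) (hπ i)
      rwa [div_eq_one_iff_eq (hη.1 i).ne'] at h
  have h3 : ∑ b, π b * Real.log ((∑ l, κ l b * y l) / ∑ l, κ l b * η l) ≤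
      ∑ b, π b * ((∑ l, κ l b * y l) / (∑ l, κ l b * η l) - 1) :=
    Finset.sum_le_sum fun b _ => mul_le_mul_of_nonneg_left
      (Real.log_le_sub_one_of_pos (div_pos (sum_mul_pos hκ hy.1 b) (sum_mul_pos hκ hη.1 b)))
      (hπ b).le
  simp only [mul_sub, mul_one, Finset.sum_sub_distrib, hπ_sum] at h2 h3
  linarith

theorem existsUnique_isMinimizer (hπ : ∀ a, 0 < π a) (hπ_sum : ∑ a, π a = 1)
    (hκ : ∀ a b, 0 < κ a b) : ∃! η : Fin K → ℝ, IsMinimizer π κ η := by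
  have := nonempty_fin_of_sum_eq_one hπ_sum
  obtain ⟨η, hη⟩ := exists_isMinimizer hπ hπ_sum hκ
  refine ⟨η, hη, fun y hy => ?_⟩
  by_contra hne
  exact (V_lt_of_critical hπ hπ_sum hκ hη.1 (hη.critical hκ hπ_sum) hy.1 hne).not_ge
    (hy.2 hη.1)

/-- The drift of the relative entropy `-∑ η_j log y_j` along the mean-field dynamics. -/
theorem sum_sq_le_entropy_drift [Nonempty (Fin K)] (hπ : ∀ a, 0 < π a)
    (hπ_sum : ∑ a, π a = 1) (hκ : ∀ a b, 0 < κ a b) {η y : Fin K → ℝ} (hη : η ∈ openSimplex K)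
    (hcrit : ∀ j, π j / η j + phi π κ η j = 2) (hy : y ∈ openSimplex K) :
    ∑ j, π j * (y j - η j) ^ 2 ≤ ∑ j, η j * (π j / y j + rate π κ y j) - 2 := by
  have hr := sum_ratio_eq_two hcrit hy.2
  have hle : ∀ {z : Fin K → ℝ}, z ∈ openSimplex K → ∀ j, z j ≤ 1 := fun {z} hz j =>
    hz.2 ▸ Finset.single_le_sum (fun i _ => (hz.1 i).le) (Finset.mem_univ j)
  have h1 : ∑ j, η j * (π j / y j) ≥
      ∑ j, (π j * (2 - y j / η j) + π j * (y j - η j) ^ 2) := by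
    refine Finset.sum_le_sum fun j _ => ?_
    have hyj := hy.1 j
    have hηj := hη.1 j
    have hπj := hπ j
    have e : η j * (π j / y j) = π j * (2 - y j / η j) + π j * ((y j - η j) ^ 2 / (y j * η j)) := by
      field_simp
      ring
    have h2 : (y j - η j) ^ 2 ≤ (y j - η j) ^ 2 / (y j * η j) :=
      -- Since `y_j η_j ≤ 1`, the exact remainder in `u/v ≥ 2 - v/u` is at least `(y_j - η_j) ^ 2`;
      -- only the coordinate terms need to supply a quantitative gain.
      le_div_self (sq_nonneg _) (by positivity)
        (mul_le_one₀ (hle hy j) hηj.le (hle hη j))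
    rw [e]
    gcongr
  have h2 : ∑ j, η j * rate π κ y j ≥
      ∑ b, π b * (2 - (∑ l, κ l b * y l) / ∑ l, κ l b * η l) := by
    have e : ∑ j, η j * rate π κ y j = ∑ b, π b * ((∑ l, κ l b * η l) / ∑ l, κ l b * y l) := by
      simp only [rate, Finset.mul_sum, Finset.sum_div]
      rw [Finset.sum_comm]
      exact Finset.sum_congr rfl fun l _ => Finset.sum_congr rfl fun b _ => by ring
    rw [e]
    refine Finset.sum_le_sum fun b _ => mul_le_mul_of_nonneg_left ?_ (hπ b).le
    have p1 := sum_mul_pos hκ hη.1 b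
    have p2 := sum_mul_pos hκ hy.1 b
    generalize ∑ l, κ l b * η l = u at *
    generalize ∑ l, κ l b * y l = v at *
    rw [← sub_nonneg, show u / v - (2 - v / u) = (u - v) ^ 2 / (u * v) by field_simp; ring]
    positivity
  simp only [mul_sub, Finset.sum_sub_distrib, Finset.sum_add_distrib, ← Finset.sum_mul, hπ_sum]
    at h1 h2
  simp only [mul_add, Finset.sum_add_distrib] at *
  linarith

/-- The relative entropy dominates the squared Hellinger distance. -/
theorem hellinger_le_entropy {η y : Fin K → ℝ} (hη : η ∈ openSimplex K) (hy : y ∈ openSimplex K) :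
    ∑ j, (√(y j) - √(η j)) ^ 2 ≤
      -∑ j, η j * Real.log (y j) - -∑ j, η j * Real.log (η j) := by
  have h : ∀ j, (√(y j) - √(η j)) ^ 2 + (η j - y j) ≤
      η j * Real.log (η j) - η j * Real.log (y j) := by
    intro j
    have hyj := hy.1 j
    have hηj := hη.1 j
    have hsy := Real.sqrt_pos.2 hyj
    have hsη := Real.sqrt_pos.2 hηj
    -- The inequality `log t ≤ t - 1` at `t = √(y_j / η_j)`, rather than at `y_j / η_j`, is what
    -- produces the square of the difference of roots.
    have hl := Real.log_le_sub_one_of_pos (div_pos hsy hsη)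
    rw [Real.log_div hsy.ne' hsη.ne', Real.log_sqrt hyj.le, Real.log_sqrt hηj.le] at hl
    have e : η j * (√(y j) / √(η j)) = √(η j) * √(y j) := by
      nth_rewrite 1 [← Real.mul_self_sqrt hηj.le]
      field_simp
    have := mul_le_mul_of_nonneg_left hl hηj.le
    rw [mul_sub, mul_sub, mul_one, e] at this
    have s1 := Real.sq_sqrt hyj.le
    have s2 := Real.sq_sqrt hηj.le
    rw [sub_sq, s1, s2]
    linarith
  have := Finset.sum_le_sum fun j (_ : j ∈ Finset.univ) => h j
  rw [Finset.sum_add_distrib, Finset.sum_sub_distrib, Finset.sum_sub_distrib, hη.2, hy.2] at this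
  linarith

end Minimizer

/-! ### Growth of the network -/

section Network

variable {K n₀ : ℕ} {κ : Fin K → Fin K → ℝ} {G₀ : SimpleGraph (Fin n₀)} {a₀ : Fin n₀ → Fin K}
  {x y : History K n₀} {n : ℕ}

/-- Every newcomer attaches to a vertex that is already present. -/
def IsValid (x : History K n₀) : Prop := ∀ n, (x n).2 ∈ vertexSet n₀ n

@[simp] theorem inl_mem_vertexSet (w : Fin n₀) : (Sum.inl w : Vertex n₀) ∈ vertexSet n₀ n := by
  simp [vertexSet]

@[simp] theorem inr_mem_vertexSet {i : ℕ} : (Sum.inr i : Vertex n₀) ∈ vertexSet n₀ n ↔ i < n := by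
  simp [vertexSet]

theorem vertexSet_succ : vertexSet n₀ (n + 1) = insert (Sum.inr n) (vertexSet n₀ n) := by
  ext (w | i)
  · simp
  · simp only [inr_mem_vertexSet, Finset.mem_insert, Sum.inr.injEq]
    omega

theorem vertexSet_mono {m : ℕ} (h : m ≤ n) : vertexSet n₀ m ⊆ vertexSet n₀ n := by
  rintro (w | i) hv
  · simp
  · simp only [inr_mem_vertexSet] at hv ⊢
    omega

theorem inr_notMem_vertexSet : (Sum.inr n : Vertex n₀) ∉ vertexSet n₀ n := by simp

/-- The first of the congruence lemmas making the time-`n` statistics functions of the first `n`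
steps. Membership in `vertexSet n₀ n` is essential: the attribute of a later vertex is not yet
determined. -/
theorem attr_congr (h : ∀ i < n, x i = y i) {v : Vertex n₀} (hv : v ∈ vertexSet n₀ n) :
    attr a₀ x v = attr a₀ y v := by
  rcases v with w | i
  · rfl
  · simp only [inr_mem_vertexSet] at hv
    simp [attr, h i hv]

theorem network_congr (h : ∀ i < n, x i = y i) : network G₀ x n = network G₀ y n := by
  have : {e : Sym2 (Vertex n₀) | ∃ i < n, e = s(Sum.inr i, (x i).2)} =
      {e | ∃ i < n, e = s(Sum.inr i, (y i).2)} := by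
    ext e
    refine exists_congr fun i => and_congr_right fun hi => ?_
    rw [h i hi]
  rw [network, network, this]

theorem deg_congr (h : ∀ i < n, x i = y i) : deg G₀ x n = deg G₀ y n := by
  funext v
  rw [deg, deg, network_congr h]

theorem attachProb_congr (h : ∀ i < n, x i = y i) (b : Fin K) {v : Vertex n₀}
    (hv : v ∈ vertexSet n₀ n) : attachProb κ G₀ a₀ x n b v = attachProb κ G₀ a₀ y n b v := by
  rw [attachProb, attachProb, attr_congr h hv, deg_congr h]
  congr 1
  exact Finset.sum_congr rfl fun w hw => by rw [attr_congr h hw]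

theorem typeVertices_congr (h : ∀ i < n, x i = y i) (a : Fin K) :
    typeVertices a₀ x n a = typeVertices a₀ y n a :=
  Finset.filter_congr fun _ hv => by rw [attr_congr h hv]

theorem typeVertices_subset (a : Fin K) : typeVertices a₀ x n a ⊆ vertexSet n₀ n :=
  Finset.filter_subset _ _

/-- Validity keeps the new edge from being a loop, which `SimpleGraph.fromEdgeSet` would discard. -/
theorem network_adj_succ (hx : IsValid x) {u v : Vertex n₀} :
    (network G₀ x (n + 1)).Adj u v ↔
      (network G₀ x n).Adj u v ∨ s(u, v) = s(Sum.inr n, (x n).2) := by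
  have hne : (Sum.inr n : Vertex n₀) ≠ (x n).2 := fun h => inr_notMem_vertexSet (h ▸ hx n)
  simp only [network, SimpleGraph.sup_adj, SimpleGraph.fromEdgeSet_adj, Set.mem_ofPred_eq,
    Nat.lt_succ_iff_lt_or_eq, or_and_right, exists_or, exists_eq_left, or_assoc]
  refine or_congr Iff.rfl (or_congr Iff.rfl ⟨fun h => h.1, fun h => ⟨h, ?_⟩⟩)
  rintro rfl
  simp only [Sym2.eq_iff] at h
  rcases h with ⟨h1, h2⟩ | ⟨h1, h2⟩
  · exact hne (h1 ▸ h2)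
  · exact hne (h2 ▸ h1)

theorem network_zero_adj {u v : Vertex n₀} :
    (network G₀ x 0).Adj u v ↔ ∃ i j, G₀.Adj i j ∧ Sum.inl i = u ∧ Sum.inl j = v := by
  simp [network]

theorem mem_vertexSet_of_adj (hx : IsValid x) {u v : Vertex n₀}
    (h : (network G₀ x n).Adj u v) : u ∈ vertexSet n₀ n := by
  induction n with
  | zero =>
    obtain ⟨i, j, -, rfl, -⟩ := network_zero_adj.1 h
    simp
  | succ n ih =>
    rcases (network_adj_succ hx).1 h with h | h
    · exact vertexSet_mono n.le_succ (ih h)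
    · rcases Sym2.eq_iff.1 h with ⟨rfl, -⟩ | ⟨rfl, -⟩
      · simp
      · exact vertexSet_mono n.le_succ (hx n)

theorem edgeSet_succ (hx : IsValid x) :
    (network G₀ x (n + 1)).edgeSet = insert s(Sum.inr n, (x n).2) (network G₀ x n).edgeSet := by
  ext e
  induction e with
  | _ u v => rw [SimpleGraph.mem_edgeSet, network_adj_succ hx, Set.mem_insert_iff, or_comm,
      SimpleGraph.mem_edgeSet]

theorem newEdge_notMem (hx : IsValid x) :
    s(Sum.inr n, (x n).2) ∉ (network G₀ x n).edgeSet := fun h =>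
  inr_notMem_vertexSet (mem_vertexSet_of_adj hx h)

theorem edgeSet_finite (hx : IsValid x) : (network G₀ x n).edgeSet.Finite := by
  refine ((vertexSet n₀ n).sym2.finite_toSet).subset fun e he => ?_
  induction e with
  | _ u v =>
    simp only [Finset.mem_coe, Finset.mk_mem_sym2_iff]
    exact ⟨mem_vertexSet_of_adj hx he, mem_vertexSet_of_adj hx he.symm⟩

theorem neighborSet_finite (hx : IsValid x) (v : Vertex n₀) :
    ((network G₀ x n).neighborSet v).Finite :=
  (vertexSet n₀ n).finite_toSet.subset fun _ hu => mem_vertexSet_of_adj hx hu.symm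

theorem deg_inr_of_le (hx : IsValid x) {i : ℕ} (h : n ≤ i) : deg G₀ x n (Sum.inr i) = 0 := by
  have : (network G₀ x n).neighborSet (Sum.inr i) = ∅ := by
    refine Set.eq_empty_of_forall_notMem fun u hu => ?_
    have := mem_vertexSet_of_adj hx hu
    simp only [inr_mem_vertexSet] at this
    omega
  simp [deg, this]

theorem deg_succ (hx : IsValid x) (v : Vertex n₀) :
    deg G₀ x (n + 1) v =
      deg G₀ x n v + (if v = (x n).2 then 1 else 0) + if v = Sum.inr n then 1 else 0 := by
  have hne : (Sum.inr n : Vertex n₀) ≠ (x n).2 := fun h => inr_notMem_vertexSet (h ▸ hx n)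
  suffices h : ((network G₀ x (n + 1)).neighborSet v).ncard =
      ((network G₀ x n).neighborSet v).ncard + (if v = (x n).2 then 1 else 0) +
        if v = Sum.inr n then 1 else 0 by
    rw [deg, deg, h]
    ring
  by_cases h1 : v = Sum.inr n
  · subst h1
    have : (network G₀ x (n + 1)).neighborSet (Sum.inr n) =
        insert (x n).2 ((network G₀ x n).neighborSet (Sum.inr n)) := by
      ext u
      simp only [SimpleGraph.mem_neighborSet, network_adj_succ hx, Set.mem_insert_iff,
        Sym2.congr_right, or_comm]
    have hmem : (x n).2 ∉ (network G₀ x n).neighborSet (Sum.inr n) := newEdge_notMem hx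
    rw [this, Set.ncard_insert_of_notMem hmem (neighborSet_finite hx _)]
    simp [hne]
  · by_cases h2 : v = (x n).2
    · have : (network G₀ x (n + 1)).neighborSet v =
          insert (Sum.inr n) ((network G₀ x n).neighborSet v) := by
        ext u
        simp only [SimpleGraph.mem_neighborSet, network_adj_succ hx, Set.mem_insert_iff, or_comm,
          ← h2, Sym2.eq_swap (a := v), Sym2.congr_left]
      rw [this, Set.ncard_insert_of_notMem _ (neighborSet_finite hx _)]
      · simp [h2, hne.symm]
      · intro h
        exact inr_notMem_vertexSet (mem_vertexSet_of_adj hx h.symm)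
    · have : (network G₀ x (n + 1)).neighborSet v = (network G₀ x n).neighborSet v := by
        ext u
        simp only [SimpleGraph.mem_neighborSet, network_adj_succ hx, Sym2.eq_iff, h1, h2,
          false_and, or_false]
      rw [this]
      simp [h1, h2]

/-- The base graph always has positive total degree. -/
theorem exists_deg_pos (hG₀ : G₀.Connected) (x : History K n₀) (n : ℕ) :
    ∃ w : Fin n₀, 0 < deg G₀ x n (Sum.inl w) := by
  obtain ⟨w⟩ := hG₀.nonempty
  refine ⟨w, ?_⟩
  by_cases h1 : n₀ = 1
  · simp [deg, h1]
  · have : Nontrivial (Fin n₀) := Fin.nontrivial_iff_two_le.2 (by have := w.pos; omega)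
    obtain ⟨u, hu⟩ := hG₀.preconnected.exists_adj_of_nontrivial w
    -- The history is arbitrary here, since transition probabilities must sum to 1 along every
    -- history, so finiteness cannot come from validity. It is needed because `ncard` of an infinite
    -- set is 0.
    have hfin : ((network G₀ x n).neighborSet (Sum.inl w)).Finite := by
      refine Set.Finite.subset (((Set.finite_range (Sum.inl : Fin n₀ → Vertex n₀)).union
        ((Finset.range n).finite_toSet.image Sum.inr)).union
        ((Finset.range n).finite_toSet.image fun i => (x i).2)) ?_
      intro v hv
      simp only [network, SimpleGraph.mem_neighborSet, SimpleGraph.sup_adj, SimpleGraph.map_adj,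
        SimpleGraph.fromEdgeSet_adj, Set.mem_ofPred_eq, Sym2.eq_iff] at hv
      rcases hv with ⟨i, j, -, -, rfl⟩ | ⟨⟨i, hi, ⟨h, -⟩ | ⟨-, rfl⟩⟩, -⟩
      · exact Or.inl (Or.inl ⟨j, rfl⟩)
      · cases h
      · exact Or.inl (Or.inr ⟨i, by simpa using hi, rfl⟩)
    have hmem : (Sum.inl u : Vertex n₀) ∈ (network G₀ x n).neighborSet (Sum.inl w) := by
      simp only [network, SimpleGraph.mem_neighborSet, SimpleGraph.sup_adj]
      exact Or.inl (SimpleGraph.map_adj_apply.2 hu)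
    have := (Set.ncard_pos hfin).2 ⟨_, hmem⟩
    rw [deg]
    omega

/-! ### Statistics of the network -/

theorem inr_notMem_typeVertices (a : Fin K) :
    (Sum.inr n : Vertex n₀) ∉ typeVertices a₀ x n a := fun h =>
  inr_notMem_vertexSet (typeVertices_subset a h)

theorem mem_typeVertices {a : Fin K} {v : Vertex n₀} :
    v ∈ typeVertices a₀ x n a ↔ v ∈ vertexSet n₀ n ∧ attr a₀ x v = a := Finset.mem_filter

theorem typeVertices_succ (a : Fin K) :
    typeVertices a₀ x (n + 1) a =
      if (x n).1 = a then insert (Sum.inr n) (typeVertices a₀ x n a)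
      else typeVertices a₀ x n a := by
  rw [typeVertices, vertexSet_succ, Finset.filter_insert]
  rfl

theorem sum_typeVertices_succ {M : Type*} [AddCommMonoid M] (a : Fin K) (g : Vertex n₀ → M) :
    ∑ v ∈ typeVertices a₀ x (n + 1) a, g v =
      ∑ v ∈ typeVertices a₀ x n a, g v + if (x n).1 = a then g (Sum.inr n) else 0 := by
  rw [typeVertices_succ]
  split_ifs
  · rw [Finset.sum_insert (inr_notMem_typeVertices a), add_comm]
  · rw [add_zero]

/-- The number of vertices of type `a`. -/
noncomputable def typeCount (a₀ : Fin n₀ → Fin K) (x : History K n₀) (n : ℕ) (a : Fin K) : ℝ :=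
  (typeVertices a₀ x n a).card

theorem typeCount_succ (a : Fin K) :
    typeCount a₀ x (n + 1) a = typeCount a₀ x n a + if (x n).1 = a then 1 else 0 := by
  simp only [typeCount, Finset.card_eq_sum_ones, Nat.cast_sum, Nat.cast_one]
  exact sum_typeVertices_succ a _

/-- The total degree of the vertices of type `a`. -/
noncomputable def typeDeg (G₀ : SimpleGraph (Fin n₀)) (a₀ : Fin n₀ → Fin K) (x : History K n₀)
    (n : ℕ) (a : Fin K) : ℝ :=
  ∑ v ∈ typeVertices a₀ x n a, (deg G₀ x n v : ℝ)

theorem typeDeg_nonneg (a : Fin K) : 0 ≤ typeDeg G₀ a₀ x n a :=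
  Finset.sum_nonneg fun _ _ => Nat.cast_nonneg _

theorem typeDeg_congr (h : ∀ i < n, x i = y i) : typeDeg G₀ a₀ x n = typeDeg G₀ a₀ y n := by
  funext a
  rw [typeDeg, typeDeg, typeVertices_congr h, deg_congr h]

theorem typeDeg_succ (hx : IsValid x) (a : Fin K) :
    typeDeg G₀ a₀ x (n + 1) a = typeDeg G₀ a₀ x n a +
      (if (x n).2 ∈ typeVertices a₀ x n a then 1 else 0) + if (x n).1 = a then 1 else 0 := by
  have hne : (Sum.inr n : Vertex n₀) ≠ (x n).2 := fun h => inr_notMem_vertexSet (h ▸ hx n)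
  rw [typeDeg, sum_typeVertices_succ]
  congr 1
  · have : ∀ v ∈ typeVertices a₀ x n a, (deg G₀ x (n + 1) v : ℝ) =
        deg G₀ x n v + if v = (x n).2 then 1 else 0 := by
      intro v hv
      have : v ≠ Sum.inr n := fun h => inr_notMem_typeVertices a (h ▸ hv)
      rw [deg_succ hx]
      simp [this]
    rw [Finset.sum_congr rfl this, Finset.sum_add_distrib, Finset.sum_ite_eq', typeDeg]
  -- The newcomer had degree 0 before its edge, hence enters with degree 1.
  · rw [deg_succ hx, deg_inr_of_le hx le_rfl]
    simp [hne]

theorem sum_typeVertices_eq_sum_vertexSet (g : Fin K → Vertex n₀ → ℝ) :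
    ∑ a, ∑ v ∈ typeVertices a₀ x n a, g a v = ∑ v ∈ vertexSet n₀ n, g (attr a₀ x v) v := by
  simp only [typeVertices]
  rw [← Finset.sum_fiberwise (vertexSet n₀ n) (attr a₀ x)]
  refine Finset.sum_congr rfl fun a _ => Finset.sum_congr rfl fun v hv => ?_
  rw [(Finset.mem_filter.1 hv).2]

theorem sum_weight_eq (b : Fin K) :
    ∑ w ∈ vertexSet n₀ n, κ (attr a₀ x w) b * (deg G₀ x n w : ℝ) =
      ∑ l, κ l b * typeDeg G₀ a₀ x n l := by
  rw [← sum_typeVertices_eq_sum_vertexSet fun l w => κ l b * (deg G₀ x n w : ℝ)]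
  simp only [typeDeg, Finset.mul_sum]

theorem weight_nonneg (hκ : ∀ a b, 0 < κ a b) (b : Fin K) (v : Vertex n₀) :
    0 ≤ κ (attr a₀ x v) b * (deg G₀ x n v : ℝ) := mul_nonneg (hκ _ _).le (Nat.cast_nonneg _)

theorem sum_weight_pos (hκ : ∀ a b, 0 < κ a b) (hG₀ : G₀.Connected) (b : Fin K) :
    0 < ∑ w ∈ vertexSet n₀ n, κ (attr a₀ x w) b * (deg G₀ x n w : ℝ) := by
  obtain ⟨w, hw⟩ := exists_deg_pos hG₀ x n
  exact Finset.sum_pos' (fun v _ => weight_nonneg hκ b v)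
    ⟨_, inl_mem_vertexSet w, mul_pos (hκ _ _) (by exact_mod_cast hw)⟩

theorem attachProb_nonneg (hκ : ∀ a b, 0 < κ a b) (b : Fin K) (v : Vertex n₀) :
    0 ≤ attachProb κ G₀ a₀ x n b v :=
  div_nonneg (weight_nonneg hκ b v) (Finset.sum_nonneg fun w _ => weight_nonneg hκ b w)

theorem sum_attachProb (hκ : ∀ a b, 0 < κ a b) (hG₀ : G₀.Connected) (b : Fin K) :
    ∑ v ∈ vertexSet n₀ n, attachProb κ G₀ a₀ x n b v = 1 := by
  simp only [attachProb, ← Finset.sum_div]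
  exact div_self (sum_weight_pos hκ hG₀ b).ne'

theorem sum_attachProb_typeVertices (a b : Fin K) :
    ∑ v ∈ typeVertices a₀ x n a, attachProb κ G₀ a₀ x n b v =
      κ a b * typeDeg G₀ a₀ x n a / ∑ l, κ l b * typeDeg G₀ a₀ x n l := by
  simp only [attachProb, sum_weight_eq, ← Finset.sum_div, typeDeg, Finset.mul_sum]
  congr 1
  exact Finset.sum_congr rfl fun v hv => by rw [(mem_typeVertices.1 hv).2]

theorem totalDeg_eq (hx : IsValid x) :
    ∑ a, typeDeg G₀ a₀ x n a = 2 * n + ∑ a, typeDeg G₀ a₀ x 0 a := by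
  induction n with
  | zero => simp
  | succ n ih =>
    simp only [typeDeg_succ hx, Finset.sum_add_distrib, ih, mem_typeVertices, hx n, true_and]
    simp
    ring

theorem totalDeg_zero_pos (hG₀ : G₀.Connected) : 0 < ∑ a, typeDeg G₀ a₀ x 0 a := by
  obtain ⟨w, -⟩ := exists_deg_pos hG₀ x 0
  have h := (sum_weight_pos (κ := fun _ _ => 1) (a₀ := a₀) (x := x) (n := 0)
    (fun _ _ => one_pos) hG₀ (a₀ w)).trans_eq (sum_weight_eq (κ := fun _ _ => 1) (a₀ := a₀) (a₀ w))
  simpa only [one_mul] using h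

/-- The vertices of type `a` and degree `k`. -/
noncomputable def degVertices (G₀ : SimpleGraph (Fin n₀)) (a₀ : Fin n₀ → Fin K)
    (x : History K n₀) (n : ℕ) (a : Fin K) (k : ℕ) : Finset (Vertex n₀) :=
  (typeVertices a₀ x n a).filter fun v => deg G₀ x n v = k

theorem degVertices_congr (h : ∀ i < n, x i = y i) :
    degVertices G₀ a₀ x n = degVertices G₀ a₀ y n := by
  funext a k
  rw [degVertices, degVertices, typeVertices_congr h, deg_congr h]

/-- The number of vertices of type `a` and degree `k`. -/
noncomputable def degCount (G₀ : SimpleGraph (Fin n₀)) (a₀ : Fin n₀ → Fin K)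
    (x : History K n₀) (n : ℕ) (a : Fin K) (k : ℕ) : ℝ :=
  (degVertices G₀ a₀ x n a k).card

/-- The target moves from its degree class to the next one, and a newcomer lands in degree 1, the
case `k = 0`. Only positive degrees are tracked. -/
theorem degCount_succ (hx : IsValid x) (a : Fin K) (k : ℕ) :
    degCount G₀ a₀ x (n + 1) a (k + 1) = degCount G₀ a₀ x n a (k + 1) +
      ((if (x n).2 ∈ degVertices G₀ a₀ x n a k then 1 else 0) -
        (if (x n).2 ∈ degVertices G₀ a₀ x n a (k + 1) then 1 else 0)) +
      if (x n).1 = a ∧ k = 0 then 1 else 0 := by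
  have hne : (Sum.inr n : Vertex n₀) ≠ (x n).2 := fun h => inr_notMem_vertexSet (h ▸ hx n)
  simp only [degCount, degVertices, Finset.card_filter, Nat.cast_sum, sum_typeVertices_succ,
    Nat.cast_add]
  congr 1
  · have : ∀ v ∈ typeVertices a₀ x n a,
        (((if deg G₀ x (n + 1) v = k + 1 then 1 else 0 : ℕ)) : ℝ) =
        ((if deg G₀ x n v = k + 1 then 1 else 0 : ℕ) : ℝ) +
        if v = (x n).2 then ((if deg G₀ x n v = k then 1 else 0) -
          (if deg G₀ x n v = k + 1 then 1 else 0)) else 0 := by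
      intro v hv
      have : v ≠ Sum.inr n := fun h => inr_notMem_typeVertices a (h ▸ hv)
      rw [deg_succ hx]
      by_cases h : v = (x n).2 <;> simp [this, h, hne.symm]
    rw [Finset.sum_congr rfl this, Finset.sum_add_distrib, Finset.sum_ite_eq']
    congr 1
    simp only [Finset.mem_filter]
    by_cases h : (x n).2 ∈ typeVertices a₀ x n a <;> simp [h]
  · rw [deg_succ hx, deg_inr_of_le hx le_rfl]
    by_cases h : (x n).1 = a <;> by_cases h' : k = 0 <;> simp [h, h', hne]

theorem sum_attachProb_degVertices (a b : Fin K) (k : ℕ) :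
    ∑ v ∈ degVertices G₀ a₀ x n a k, attachProb κ G₀ a₀ x n b v =
      κ a b * (k * degCount G₀ a₀ x n a k) / ∑ l, κ l b * typeDeg G₀ a₀ x n l := by
  have : ∀ v ∈ degVertices G₀ a₀ x n a k, attachProb κ G₀ a₀ x n b v =
      κ a b * k / ∑ l, κ l b * typeDeg G₀ a₀ x n l := by
    intro v hv
    obtain ⟨h1, h2⟩ := Finset.mem_filter.1 hv
    rw [attachProb, sum_weight_eq, (mem_typeVertices.1 h1).2, h2]
  rw [Finset.sum_congr rfl this, Finset.sum_const, degCount, nsmul_eq_mul]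
  ring

theorem card_edgeSet (hx : IsValid x) :
    (network G₀ x n).edgeSet.ncard = n + (network G₀ x 0).edgeSet.ncard := by
  induction n with
  | zero => simp
  | succ n ih =>
    rw [edgeSet_succ hx, Set.ncard_insert_of_notMem (newEdge_notMem hx) (edgeSet_finite hx), ih]
    ring

theorem numEdges_succ (hx : IsValid x) (a b : Fin K) :
    numEdges G₀ a₀ x (n + 1) a b = numEdges G₀ a₀ x n a b +
      if s((x n).1, attr a₀ x (x n).2) = s(a, b) then 1 else 0 := by
  rw [numEdges, edgeSet_succ hx]
  have hmap : (s(Sum.inr n, (x n).2)).map (attr a₀ x) = s((x n).1, attr a₀ x (x n).2) := rfl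
  have hsep : {e ∈ insert s(Sum.inr n, (x n).2) (network G₀ x n).edgeSet |
        e.map (attr a₀ x) = s(a, b)} =
      if s((x n).1, attr a₀ x (x n).2) = s(a, b) then
        insert s(Sum.inr n, (x n).2)
          {e ∈ (network G₀ x n).edgeSet | e.map (attr a₀ x) = s(a, b)}
      else {e ∈ (network G₀ x n).edgeSet | e.map (attr a₀ x) = s(a, b)} := by
    split_ifs with h
    · ext e
      simp only [Set.mem_ofPred_eq, Set.mem_insert_iff]
      constructor
      · rintro ⟨rfl | h1, h2⟩
        · exact Or.inl rfl
        · exact Or.inr ⟨h1, h2⟩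
      · rintro (rfl | ⟨h1, h2⟩)
        · exact ⟨Or.inl rfl, hmap.trans h⟩
        · exact ⟨Or.inr h1, h2⟩
    · ext e
      simp only [Set.mem_ofPred_eq, Set.mem_insert_iff]
      refine ⟨?_, fun h => ⟨Or.inr h.1, h.2⟩⟩
      rintro ⟨rfl | h1, h2⟩
      · exact absurd (hmap.symm.trans h2) h
      · exact ⟨h1, h2⟩
  rw [hsep]
  split_ifs with h
  · rw [Set.ncard_insert_of_notMem (fun h => newEdge_notMem hx h.1)
      ((edgeSet_finite hx).subset (Set.sep_subset _ _)), numEdges]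
  · rw [add_zero, numEdges]

theorem numEdges_self_succ (hx : IsValid x) (a : Fin K) :
    (numEdges G₀ a₀ x (n + 1) a a : ℝ) = numEdges G₀ a₀ x n a a +
      if (x n).1 = a ∧ (x n).2 ∈ typeVertices a₀ x n a then 1 else 0 := by
  rw [numEdges_succ hx]
  simp [mem_typeVertices, hx n]

/-- An undirected edge between distinct types arises from two disjoint events, according to which
endpoint is the newcomer; these yield the two terms of the heterophily limit. -/
theorem numEdges_ne_succ (hx : IsValid x) {a b : Fin K} (hab : a ≠ b) :
    (numEdges G₀ a₀ x (n + 1) a b : ℝ) = numEdges G₀ a₀ x n a b +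
      ((if (x n).1 = a ∧ (x n).2 ∈ typeVertices a₀ x n b then 1 else 0) +
        if (x n).1 = b ∧ (x n).2 ∈ typeVertices a₀ x n a then 1 else 0) := by
  rw [numEdges_succ hx]
  simp only [mem_typeVertices, hx n, true_and, Sym2.eq_iff]
  by_cases h1 : (x n).1 = a <;> by_cases h2 : (x n).1 = b <;>
    by_cases h3 : attr a₀ x (x n).2 = a <;> by_cases h4 : attr a₀ x (x n).2 = b <;>
    simp_all

end Network

/-! ### Processes with finitely supported transition probabilities -/

section Trajectories

variable {Ω α : Type*} [MeasurableSpace α] {X : ℕ → Ω → α} {S : ℕ → Finset α}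
  {p : ℕ → (ℕ → α) → α → ℝ}

/-- The function `F` of a trajectory depends on the first `n` coordinates only. -/
def DependsOnPast {β : Type*} (n : ℕ) (F : (ℕ → α) → β) : Prop :=
  ∀ h h' : ℕ → α, (∀ i < n, h i = h' i) → F h = F h'

/-- `X` is a process for which `p n h` is the conditional law of `X n` given that
`X i = h i` for `i < n`, and this law is supported in `S n`. -/
structure HasTransition [MeasurableSpace Ω] (μ : Measure Ω) (X : ℕ → Ω → α) (S : ℕ → Finset α)
    (p : ℕ → (ℕ → α) → α → ℝ) : Prop where
  measurable : ∀ n, Measurable (X n)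
  nonneg : ∀ n h s, 0 ≤ p n h s
  sum_eq_one : ∀ n h, ∑ s ∈ S n, p n h s = 1
  past : ∀ n, ∀ s ∈ S n, DependsOnPast n fun h => p n h s
  law : ∀ n h, ∀ s ∈ S n, μ {ω | (∀ i < n, X i ω = h i) ∧ X n ω = s} =
    μ {ω | ∀ i < n, X i ω = h i} * ENNReal.ofReal (p n h s)

/-- The conditional mean of `f (X n)` given the past. -/
def condMean (S : ℕ → Finset α) (p : ℕ → (ℕ → α) → α → ℝ) (n : ℕ) (f : α → ℝ) (h : ℕ → α) : ℝ :=
  ∑ s ∈ S n, p n h s * f s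

/-- The `σ`-algebra generated by the first `n` variables. -/
abbrev pastSigma (X : ℕ → Ω → α) (n : ℕ) : MeasurableSpace Ω :=
  MeasurableSpace.comap (fun ω (i : Fin n) => X i ω) inferInstance

namespace HasTransition

variable [MeasurableSpace Ω] {μ : Measure Ω} (hX : HasTransition μ X S p)
include hX

theorem condMean_past {n : ℕ} {f : (ℕ → α) → α → ℝ} (hf : DependsOnPast n f) :
    DependsOnPast n fun h => condMean S p n (f h) h := by
  intro h h' hh
  refine Finset.sum_congr rfl fun s hs => ?_
  have := hX.past n s hs h h' hh
  simp only at this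
  rw [hf h h' hh, this]

theorem abs_condMean_le {n : ℕ} {f : α → ℝ} {C : ℝ} (hC : ∀ s, |f s| ≤ C) (h : ℕ → α) :
    |condMean S p n f h| ≤ C := by
  refine (Finset.abs_sum_le_sum_abs _ _).trans ?_
  calc ∑ s ∈ S n, |p n h s * f s| ≤ ∑ s ∈ S n, p n h s * C := by
        refine Finset.sum_le_sum fun s _ => ?_
        rw [abs_mul, abs_of_nonneg (hX.nonneg n h s)]
        exact mul_le_mul_of_nonneg_left (hC s) (hX.nonneg n h s)
    _ = C := by rw [← Finset.sum_mul, hX.sum_eq_one, one_mul]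

theorem centered_past {n : ℕ} {f : (ℕ → α) → α → ℝ} (hf : DependsOnPast n f) :
    DependsOnPast (n + 1) fun h => f h (h n) - condMean S p n (f h) h := by
  intro h h' hh
  have h1 : ∀ i < n, h i = h' i := fun i hi => hh i (by omega)
  have := hX.condMean_past hf h h' h1
  simp only at this ⊢
  rw [this, hf h h' h1, hh n n.lt_succ_self]

theorem abs_centered_le {n : ℕ} {f : (ℕ → α) → α → ℝ} {C : ℝ} (hC : ∀ h s, |f h s| ≤ C)
    (h : ℕ → α) : |f h (h n) - condMean S p n (f h) h| ≤ 2 * C := by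
  have := abs_sub (f h (h n)) (condMean S p n (f h) h)
  linarith [hC h (h n), hX.abs_condMean_le (n := n) (hC h) h]

end HasTransition

/-- Such a function factors through the first `n` coordinates, the remaining ones being filled with
a default value, and every map out of the discrete space `Fin n → α` is measurable. -/
theorem measurable_pastSigma [Countable α] [DiscreteMeasurableSpace α] [Nonempty α]
    {β : Type*} [MeasurableSpace β] {n : ℕ} {F : (ℕ → α) → β} (hF : DependsOnPast n F) :
    Measurable[pastSigma X n] fun ω => F fun i => X i ω := by
  classical
  obtain ⟨d⟩ := ‹Nonempty α›
  have : (fun ω => F fun i => X i ω) =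
      (fun g : Fin n → α => F fun i => if h : i < n then g ⟨i, h⟩ else d) ∘
        fun ω (i : Fin n) => X i ω := by
    funext ω
    refine hF _ _ fun i hi => ?_
    simp [hi]
  rw [this]
  exact (Measurable.of_discrete).comp (comap_measurable _)

variable [MeasurableSpace Ω]

theorem pastSigma_le (hX : ∀ n, Measurable (X n)) (n : ℕ) :
    pastSigma X n ≤ ‹MeasurableSpace Ω› :=
  Measurable.comap_le (f := fun ω (i : Fin n) => X i ω) (measurable_pi_lambda _ fun i => hX i)

namespace HasTransition

/-- The prescribed masses of the points of `S n` already exhaust the cylinder, so on it `f (X n)` is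
almost everywhere a finite combination of indicators and no integrability assumption on `f` is
needed. -/
theorem setIntegral_cylinder [DiscreteMeasurableSpace α] {μ : Measure Ω}
    [IsProbabilityMeasure μ] (hX : HasTransition μ X S p) (n : ℕ) (h : ℕ → α) (f : α → ℝ) :
    ∫ ω in {ω | ∀ i < n, X i ω = h i}, f (X n ω) ∂μ =
      μ.real {ω | ∀ i < n, X i ω = h i} * condMean S p n f h := by
  classical
  set C := {ω | ∀ i < n, X i ω = h i} with hC
  have hmX : ∀ s, MeasurableSet (X n ⁻¹' {s}) := fun s => hX.measurable n (.of_discrete)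
  have hlaw : ∀ s ∈ S n, (μ.restrict C) (X n ⁻¹' {s}) = μ C * ENNReal.ofReal (p n h s) := by
    intro s hs
    rw [Measure.restrict_apply (hmX s), ← hX.law n h s hs]
    congr 1
    ext ω
    simp [hC, and_comm]
  have hsupp : ∀ᵐ ω ∂(μ.restrict C), X n ω ∈ S n := by
    have hm : MeasurableSet (X n ⁻¹' (S n : Set α)) := hX.measurable n (.of_discrete)
    have htot : (μ.restrict C) (X n ⁻¹' (S n : Set α)) = (μ.restrict C) Set.univ := by
      rw [← sum_measure_preimage_singleton _ fun s _ => hmX s, Finset.sum_congr rfl hlaw,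
        ← Finset.mul_sum, ← ENNReal.ofReal_sum_of_nonneg fun s _ => hX.nonneg n h s,
        hX.sum_eq_one, ENNReal.ofReal_one, mul_one, Measure.restrict_apply_univ]
    exact (ae_iff_measure_eq hm.nullMeasurableSet).2 htot
  have hae : (fun ω => f (X n ω)) =ᵐ[μ.restrict C]
      fun ω => ∑ s ∈ S n, (X n ⁻¹' {s}).indicator (fun _ => f s) ω := by
    filter_upwards [hsupp] with ω hω
    rw [Finset.sum_eq_single_of_mem (X n ω) hω]
    · simp
    · intro s _ hs
      simp [hs.symm]
  rw [integral_congr_ae hae, integral_finsetSum _ fun s _ =>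
    (integrable_const (f s)).indicator (hmX s), condMean, Finset.mul_sum]
  refine Finset.sum_congr rfl fun s hs => ?_
  rw [integral_indicator_const _ (hmX s), measureReal_def, hlaw s hs, ENNReal.toReal_mul,
    ENNReal.toReal_ofReal (hX.nonneg n h s), smul_eq_mul, measureReal_def, mul_assoc]

end HasTransition

variable [Countable α] [DiscreteMeasurableSpace α]

/-- The filtration generated by `X`. -/
def pastFiltration [Nonempty α] (hX : ∀ n, Measurable (X n)) :
    Filtration ℕ ‹MeasurableSpace Ω› where
  seq := pastSigma X
  mono' := by
    intro m n hmn
    refine measurable_iff_comap_le.1 (measurable_pastSigma (X := X)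
      (F := fun h (i : Fin m) => h i) fun h h' hh => ?_)
    funext i
    exact hh i (by have := i.2; omega)
  le' := pastSigma_le hX

theorem measurable_of_past [Nonempty α] (hX : ∀ n, Measurable (X n)) {n : ℕ}
    {F : (ℕ → α) → ℝ} (hF : DependsOnPast n F) : Measurable fun ω => F fun i => X i ω :=
  (measurable_pastSigma hF).mono (pastSigma_le hX n) le_rfl

theorem integrable_of_past [Nonempty α] {μ : Measure Ω} [IsFiniteMeasure μ]
    (hX : ∀ n, Measurable (X n)) {n : ℕ} {C : ℝ} {F : (ℕ → α) → ℝ} (hF : DependsOnPast n F) (hC : ∀ h, |F h| ≤ C) :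
    Integrable (fun ω => F fun i => X i ω) μ :=
  Integrable.of_bound (measurable_of_past hX hF).aestronglyMeasurable C
    (Eventually.of_forall fun _ => hC _)

namespace HasTransition

variable {μ : Measure Ω} [IsProbabilityMeasure μ] (hX : HasTransition μ X S p)
include hX

variable [Nonempty α]

/-- The values of the first `n` variables split `Ω` into countably many cylinders. On each one the
function `f` and its conditional mean are frozen, so the integral vanishes by
`setIntegral_cylinder`. -/
theorem integral_centered {n : ℕ} {f : (ℕ → α) → α → ℝ} {C : ℝ} (hf : DependsOnPast n f)
    (hC : ∀ h s, |f h s| ≤ C) :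
    ∫ ω, (f (fun i => X i ω) (X n ω) - condMean S p n (f fun i => X i ω) fun i => X i ω) ∂μ
      = 0 := by
  classical
  obtain ⟨d⟩ := id ‹Nonempty α›
  set D : Ω → ℝ := fun ω =>
    f (fun i => X i ω) (X n ω) - condMean S p n (f fun i => X i ω) fun i => X i ω with hD
  have hDint : Integrable D μ :=
    integrable_of_past hX.measurable (hX.centered_past hf) (hX.abs_centered_le hC)
  set H : Ω → Fin n → α := fun ω i => X i ω with hH
  have hHm : Measurable H := measurable_pi_lambda _ fun i => hX.measurable i
  have hcell : ∀ g : Fin n → α, ∫ ω in H ⁻¹' {g}, D ω ∂μ = 0 := by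
    intro g
    set h : ℕ → α := fun i => if hi : i < n then g ⟨i, hi⟩ else d with hh
    have hset : H ⁻¹' {g} = {ω | ∀ i < n, X i ω = h i} := by
      ext ω
      simp only [Set.mem_preimage, Set.mem_singleton_iff, funext_iff, Set.mem_ofPred_eq, hH]
      constructor
      · intro h1 i hi
        simpa [hh, hi] using h1 ⟨i, hi⟩
      · intro h1 i
        simpa [hh] using h1 i i.2
    have hm : MeasurableSet (H ⁻¹' {g}) := hHm (.of_discrete)
    have hcongr : ∀ ω ∈ H ⁻¹' {g}, D ω = f h (X n ω) - condMean S p n (f h) h := by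
      intro ω hω
      rw [hset] at hω
      have h2 := hX.condMean_past hf _ _ hω
      simp only at h2
      rw [← h2]
      simp only [hD, hf _ _ hω]
    have hint : Integrable (fun ω => f h (X n ω)) μ :=
      Integrable.of_bound ((Measurable.of_discrete (f := f h)).comp
        (hX.measurable n)).aestronglyMeasurable C (Eventually.of_forall fun ω => hC _ _)
    rw [setIntegral_congr_fun hm hcongr, integral_sub hint.integrableOn (integrable_const _),
      hset, hX.setIntegral_cylinder, setIntegral_const, smul_eq_mul, sub_self]
  have huniv : ⋃ g, H ⁻¹' {g} = Set.univ := by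
    ext ω
    simp
  have := integral_iUnion (μ := μ) (f := D) (s := fun g => H ⁻¹' {g})
    (fun g => hHm (.of_discrete)) (fun g g' hgg => Set.disjoint_left.2 fun ω h1 h2 => hgg
      (by rw [← Set.mem_singleton_iff.1 h1, ← Set.mem_singleton_iff.1 h2])) hDint.integrableOn
  rw [huniv, setIntegral_univ] at this
  rw [this]
  simp only [hcell, tsum_zero]

/-- Orthogonality of a centred increment to the past. -/
theorem integral_mul_centered {n : ℕ} {f : (ℕ → α) → α → ℝ} {w : (ℕ → α) → ℝ} {C B : ℝ}
    (hf : DependsOnPast n f) (hC : ∀ h s, |f h s| ≤ C) (hw : DependsOnPast n w)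
    (hB : ∀ h, |w h| ≤ B) :
    ∫ ω, w (fun i => X i ω) *
      (f (fun i => X i ω) (X n ω) - condMean S p n (f fun i => X i ω) fun i => X i ω) ∂μ = 0 := by
  have hwf : DependsOnPast n fun h s => w h * f h s := by
    intro h h' hh
    simp only [hf h h' hh, hw h h' hh]
  -- A predictable weight passes through `condMean`, so the product is itself the centred increment
  -- of `w * f`.
  rw [← hX.integral_centered (C := B * C) hwf fun h s => by
    rw [abs_mul]
    exact mul_le_mul (hB h) (hC h s) (abs_nonneg _) ((abs_nonneg _).trans (hB h))]
  refine integral_congr_ae (Eventually.of_forall fun ω => ?_)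
  simp only [condMean, mul_sub, Finset.mul_sum]
  congr 1
  exact Finset.sum_congr rfl fun s _ => by ring

theorem ae_mem (n : ℕ) : ∀ᵐ ω ∂μ, X n ω ∈ S n := by
  classical
  have h := hX.integral_centered (n := n) (C := 1) (f := fun _ s => if s ∈ S n then 0 else 1)
    (fun _ _ _ => rfl) fun _ s => by split_ifs <;> simp
  have h0 : ∀ h, condMean S p n (fun s => if s ∈ S n then (0 : ℝ) else 1) h = 0 := fun h =>
    Finset.sum_eq_zero fun s hs => by simp [hs]
  simp only [h0, sub_zero] at h
  rw [integral_eq_zero_iff_of_nonneg (fun ω => by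
    show 0 ≤ if X n ω ∈ S n then (0 : ℝ) else 1
    split_ifs <;> simp)] at h
  · filter_upwards [h] with ω hω
    by_contra hcon
    simp [hcon] at hω
  · exact Integrable.of_bound ((Measurable.of_discrete
      (f := fun s => if s ∈ S n then (0 : ℝ) else 1)).comp
        (hX.measurable n)).aestronglyMeasurable 1 (Eventually.of_forall fun ω => by
          show ‖if X n ω ∈ S n then (0 : ℝ) else 1‖ ≤ 1
          split_ifs <;> simp)

/-- Almost sure convergence of the series of centred increments with weights `1 / (n + 1)`. -/
theorem ae_tendsto_sum_centered {f : ℕ → (ℕ → α) → α → ℝ} {C : ℝ}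
    (hf : ∀ n, DependsOnPast n (f n)) (hC : ∀ n h s, |f n h s| ≤ C) :
    ∀ᵐ ω ∂μ, ∃ l, Tendsto (fun n => ∑ i ∈ Finset.range n,
      (f i (fun j => X j ω) (X i ω) - condMean S p i (f i fun j => X j ω) fun j => X j ω) /
        ((i : ℝ) + 1)) atTop (𝓝 l) := by
  set d : ℕ → (ℕ → α) → ℝ := fun n h => f n h (h n) - condMean S p n (f n h) h with hd
  set m : ℕ → (ℕ → α) → ℝ := fun n h => ∑ i ∈ Finset.range n, d i h / ((i : ℝ) + 1) with hm
  have hdp : ∀ n, DependsOnPast (n + 1) (d n) := fun n => hX.centered_past (hf n)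
  have hdC : ∀ n h, |d n h| ≤ 2 * C := fun n => hX.abs_centered_le (hC n)
  have hmp : ∀ n, DependsOnPast n (m n) := fun n h h' hh =>
    Finset.sum_congr rfl fun i hi => by
      rw [hdp i h h' fun j hj => hh j (by have := Finset.mem_range.1 hi; omega)]
  have hmB : ∀ n h, |m n h| ≤ ∑ i ∈ Finset.range n, 2 * C / ((i : ℝ) + 1) := by
    intro n h
    refine (Finset.abs_sum_le_sum_abs _ _).trans (Finset.sum_le_sum fun i _ => ?_)
    rw [abs_div, abs_of_pos (show (0 : ℝ) < i + 1 by positivity)]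
    have := hdC i h
    gcongr
  have hdint : ∀ n, Integrable (fun ω => d n fun j => X j ω) μ := fun n =>
    integrable_of_past hX.measurable (hdp n) (hdC n)
  have hmint : ∀ n, Integrable (fun ω => m n fun j => X j ω) μ := fun n =>
    integrable_of_past hX.measurable (hmp n) (hmB n)
  set ℱ := pastFiltration hX.measurable with hℱ
  have hmart : Martingale (fun n ω => m n fun j => X j ω) ℱ μ := by
    refine martingale_of_condExp_sub_eq_zero_nat
      (fun n => (measurable_pastSigma (hmp n)).stronglyMeasurable) hmint fun n => ?_
    have hstep : ((fun ω => m (n + 1) fun j => X j ω) - fun ω => m n fun j => X j ω) =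
        fun ω => d n (fun j => X j ω) / ((n : ℝ) + 1) := by
      funext ω
      simp [hm, Finset.sum_range_succ]
    rw [hstep]
    refine (ae_eq_condExp_of_forall_setIntegral_eq (ℱ.le n) ((hdint n).div_const _)
      (fun s _ _ => integrableOn_zero) (fun s hs _ => ?_) aestronglyMeasurable_zero).symm
    obtain ⟨B, -, rfl⟩ := hs
    have hmB : MeasurableSet ((fun ω (i : Fin n) => X i ω) ⁻¹' B) :=
      measurable_pi_lambda (fun ω (i : Fin n) => X i ω) (fun i => hX.measurable i) (.of_discrete)
    -- An event of the past is the preimage of some `B`; its indicator serves as the predictable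
    -- weight.
    have h0 := hX.integral_mul_centered (w := fun h => B.indicator (fun _ => (1 : ℝ)) fun i => h i)
      (B := 1) (hf n) (hC n) (fun h h' hh =>
        congrArg (B.indicator fun _ => (1 : ℝ)) (funext fun i => hh i i.2)) fun h => by
          by_cases hB : (fun i : Fin n => h i) ∈ B <;> simp [hB]
    simp only [integral_zero]
    rw [integral_div, ← integral_indicator hmB, eq_comm, div_eq_zero_iff]
    left
    rw [← h0]
    refine integral_congr_ae (Eventually.of_forall fun ω => ?_)
    by_cases hB : (fun i : Fin n => X i ω) ∈ B <;> simp [hB, hd, Set.indicator]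
  have hm2int : ∀ n, Integrable (fun ω => (m n fun j => X j ω) ^ 2) μ := by
    intro n
    refine integrable_of_past (n := n)
      (C := (∑ i ∈ Finset.range n, 2 * C / ((i : ℝ) + 1)) ^ 2)
      (F := fun h => m n h ^ 2) hX.measurable
      (fun h h' hh => by simp only [hmp n h h' hh]) fun h => ?_
    rw [abs_pow]
    exact pow_le_pow_left₀ (abs_nonneg _) (hmB n h) 2
  -- Increments are orthogonal to the past, so second moments add; each contributes at most `(2C)² /
  -- (i + 1)²`, which is summable.
  have hL2 : ∀ n, ∫ ω, (m n fun j => X j ω) ^ 2 ∂μ ≤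
      4 * C ^ 2 * ∑ i ∈ Finset.range n, 1 / ((i : ℝ) + 1) ^ 2 := by
    intro n
    induction n with
    | zero => simp [hm]
    | succ n ih =>
      have hC0 : ∀ h, d n h ^ 2 ≤ 4 * C ^ 2 := fun h => by
        rw [← sq_abs, show 4 * C ^ 2 = (2 * C) ^ 2 by ring]
        exact pow_le_pow_left₀ (abs_nonneg _) (hdC n h) 2
      have horth := hX.integral_mul_centered (hf n) (hC n) (hmp n) (hmB n)
      have e : ∀ ω, (m (n + 1) fun j => X j ω) ^ 2 = (m n fun j => X j ω) ^ 2 +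
          2 / ((n : ℝ) + 1) * ((m n fun j => X j ω) * d n fun j => X j ω) +
          (d n fun j => X j ω) ^ 2 * (1 / ((n : ℝ) + 1) ^ 2) := by
        intro ω
        simp only [hm, Finset.sum_range_succ]
        field_simp
        ring
      have i1 := hm2int n
      have i2 : Integrable (fun ω => (m n fun j => X j ω) * d n fun j => X j ω) μ := by
        refine integrable_of_past (n := n + 1)
          (C := (∑ i ∈ Finset.range n, 2 * C / ((i : ℝ) + 1)) * (2 * C))
          (F := fun h => m n h * d n h) hX.measurable
          (fun h h' hh => by
            simp only [hmp n h h' fun i hi => hh i (by omega), hdp n h h' hh]) fun h => ?_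
        rw [abs_mul]
        exact mul_le_mul (hmB n h) (hdC n h) (abs_nonneg _) ((abs_nonneg _).trans (hmB n h))
      have i3 : Integrable (fun ω => (d n fun j => X j ω) ^ 2) μ := by
        refine integrable_of_past (n := n + 1) (C := 4 * C ^ 2)
          (F := fun h => d n h ^ 2) hX.measurable
          (fun h h' hh => by simp only [hdp n h h' hh]) fun h => ?_
        rw [abs_of_nonneg (sq_nonneg _)]
        exact hC0 h
      have i3le : ∫ ω, (d n fun j => X j ω) ^ 2 ∂μ ≤ 4 * C ^ 2 := by
        have := integral_mono i3 (integrable_const (4 * C ^ 2)) fun ω => hC0 _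
        simpa using this
      have e1 : ∫ ω, (m (n + 1) fun j => X j ω) ^ 2 ∂μ =
          ∫ ω, (m n fun j => X j ω) ^ 2 ∂μ +
            ∫ ω, 2 / ((n : ℝ) + 1) * ((m n fun j => X j ω) * d n fun j => X j ω) ∂μ +
            ∫ ω, (d n fun j => X j ω) ^ 2 * (1 / ((n : ℝ) + 1) ^ 2) ∂μ := by
        rw [← integral_add i1 (i2.const_mul _), ← integral_add _ (i3.mul_const _)]
        · exact integral_congr_ae (Eventually.of_forall e)
        · exact i1.add (i2.const_mul _)
      rw [e1, integral_const_mul, integral_mul_const, horth, Finset.sum_range_succ, mul_add]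
      have : (∫ ω, (d n fun j => X j ω) ^ 2 ∂μ) * (1 / ((n : ℝ) + 1) ^ 2) ≤
          4 * C ^ 2 * (1 / ((n : ℝ) + 1) ^ 2) := by gcongr
      linarith
  have hsum : Summable fun i : ℕ => 1 / ((i : ℝ) + 1) ^ 2 := by
    have := (summable_nat_add_iff 1).2 (Real.summable_one_div_nat_pow.2 one_lt_two)
    simpa using this
  set R : ℝ := 4 * C ^ 2 * ∑' i : ℕ, 1 / ((i : ℝ) + 1) ^ 2 + 1 with hR
  -- The martingale convergence theorem asks for an `L¹` bound, obtained from `|m| ≤ m² + 1`.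
  have hL1 : ∀ n, ∫ ω, |m n fun j => X j ω| ∂μ ≤ R := by
    intro n
    calc ∫ ω, |m n fun j => X j ω| ∂μ ≤ ∫ ω, ((m n fun j => X j ω) ^ 2 + 1) ∂μ := by
          refine integral_mono (hmint n).abs ((hm2int n).add (integrable_const 1)) fun ω => ?_
          simp only
          rw [← sq_abs]
          nlinarith [sq_nonneg (|m n fun j => X j ω| - 1), abs_nonneg (m n fun j => X j ω)]
      _ ≤ R := by
          rw [integral_add (hm2int n) (integrable_const 1)]
          have h1 : ∑ i ∈ Finset.range n, 1 / ((i : ℝ) + 1) ^ 2 ≤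
              ∑' i : ℕ, 1 / ((i : ℝ) + 1) ^ 2 :=
            hsum.sum_le_tsum _ fun i _ => by positivity
          have h2 := (hL2 n).trans (mul_le_mul_of_nonneg_left h1 (by positivity))
          simpa [hR] using h2
  have hconv := hmart.submartingale.ae_tendsto_limitProcess (R := R.toNNReal) fun n => by
    rw [eLpNorm_one_eq_lintegral_enorm, ← ofReal_integral_norm_eq_lintegral_enorm (hmint n)]
    exact ENNReal.ofReal_le_ofReal (hL1 n)
  filter_upwards [hconv] with ω hω
  exact ⟨_, hω⟩

end HasTransition

end Trajectories

/-! ### The model as a process with transition probabilities -/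

instance {α β : Type*} [MeasurableSpace α] [MeasurableSpace β] [DiscreteMeasurableSpace α]
    [DiscreteMeasurableSpace β] : DiscreteMeasurableSpace (α ⊕ β) :=
  ⟨fun _ => measurableSet_sum_iff.2 ⟨.of_discrete, .of_discrete⟩⟩

/-- The possible values of a growth step. -/
def stepSupport (K n₀ n : ℕ) : Finset (Fin K × Vertex n₀) := Finset.univ ×ˢ vertexSet n₀ n

/-- The conditional law of a growth step. -/
noncomputable def stepProb {K n₀ : ℕ} (π : Fin K → ℝ) (κ : Fin K → Fin K → ℝ)
    (G₀ : SimpleGraph (Fin n₀)) (a₀ : Fin n₀ → Fin K) (n : ℕ) (x : History K n₀)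
    (s : Fin K × Vertex n₀) : ℝ :=
  π s.1 * attachProb κ G₀ a₀ x n s.1 s.2

section Steps

variable {K n₀ : ℕ} {π : Fin K → ℝ} {κ : Fin K → Fin K → ℝ} {G₀ : SimpleGraph (Fin n₀)}
  {a₀ : Fin n₀ → Fin K} {x : History K n₀} {n : ℕ}

theorem IsModel.hasTransition {Ω : Type*} [MeasurableSpace Ω] {μ : Measure Ω}
    {X : ℕ → Ω → Fin K × Vertex n₀} (hπ : ∀ a, 0 < π a) (hπ_sum : ∑ a, π a = 1)
    (hκ : ∀ a b, 0 < κ a b) (hG₀ : G₀.Connected) (hX : IsModel μ π κ G₀ a₀ X) :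
    HasTransition μ X (stepSupport K n₀) (stepProb π κ G₀ a₀) where
  measurable := hX.measurable
  nonneg n h s := mul_nonneg (hπ _).le (attachProb_nonneg hκ _ _)
  sum_eq_one n h := by
    simp only [stepSupport, stepProb, Finset.sum_product, ← Finset.mul_sum, sum_attachProb hκ hG₀,
      mul_one, hπ_sum]
  past n s hs h h' hh := by
    simp only [stepProb]
    rw [attachProb_congr hh _ (Finset.mem_product.1 hs).2]
  law n h s hs := by
    have h1 := hX.attach_law n h s.1 s.2 (Finset.mem_product.1 hs).2
    rw [hX.attr_law, mul_assoc, ← ENNReal.ofReal_mul (hπ _).le] at h1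
    rw [stepProb, ← h1]
    simp only [Prod.ext_iff]

theorem condMean_add (f g : Fin K × Vertex n₀ → ℝ) :
    condMean (stepSupport K n₀) (stepProb π κ G₀ a₀) n (fun s => f s + g s) x =
      condMean (stepSupport K n₀) (stepProb π κ G₀ a₀) n f x +
        condMean (stepSupport K n₀) (stepProb π κ G₀ a₀) n g x := by
  simp only [condMean, mul_add, Finset.sum_add_distrib]

theorem condMean_sub (f g : Fin K × Vertex n₀ → ℝ) :
    condMean (stepSupport K n₀) (stepProb π κ G₀ a₀) n (fun s => f s - g s) x =
      condMean (stepSupport K n₀) (stepProb π κ G₀ a₀) n f x -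
        condMean (stepSupport K n₀) (stepProb π κ G₀ a₀) n g x := by
  simp only [condMean, mul_sub, Finset.sum_sub_distrib]

theorem condMean_sum_mul (c : Fin K → ℝ) (f : Fin K → Fin K × Vertex n₀ → ℝ) :
    condMean (stepSupport K n₀) (stepProb π κ G₀ a₀) n (fun s => ∑ j, c j * f j s) x =
      ∑ j, c j * condMean (stepSupport K n₀) (stepProb π κ G₀ a₀) n (f j) x := by
  simp only [condMean, Finset.mul_sum]
  rw [Finset.sum_comm]
  exact Finset.sum_congr rfl fun j _ => Finset.sum_congr rfl fun s _ => by ring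

theorem condMean_attr (hκ : ∀ a b, 0 < κ a b) (hG₀ : G₀.Connected) (a : Fin K) :
    condMean (stepSupport K n₀) (stepProb π κ G₀ a₀) n (fun s => if s.1 = a then 1 else 0) x =
      π a := by
  simp only [condMean, stepSupport, stepProb, Finset.sum_product, ← Finset.mul_sum, mul_assoc]
  simp [sum_attachProb hκ hG₀]

theorem condMean_edge {W : Finset (Vertex n₀)} (hW : W ⊆ vertexSet n₀ n) (b : Fin K) :
    condMean (stepSupport K n₀) (stepProb π κ G₀ a₀) n
      (fun s => if s.1 = b ∧ s.2 ∈ W then 1 else 0) x =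
      π b * ∑ v ∈ W, attachProb κ G₀ a₀ x n b v := by
  simp only [condMean, stepSupport, stepProb, Finset.sum_product]
  rw [Finset.sum_eq_single_of_mem b (Finset.mem_univ b) fun b' _ hb' => by simp [hb']]
  simp only [true_and, mul_ite, mul_one, mul_zero]
  rw [← Finset.sum_filter, Finset.filter_mem_eq_inter, Finset.inter_eq_right.2 hW, Finset.mul_sum]

theorem condMean_target {W : Finset (Vertex n₀)} (hW : W ⊆ vertexSet n₀ n) :
    condMean (stepSupport K n₀) (stepProb π κ G₀ a₀) n
      (fun s => if s.2 ∈ W then 1 else 0) x =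
      ∑ b, π b * ∑ v ∈ W, attachProb κ G₀ a₀ x n b v := by
  simp only [condMean, stepSupport, stepProb, Finset.sum_product]
  refine Finset.sum_congr rfl fun b _ => ?_
  simp only [mul_ite, mul_one, mul_zero]
  rw [← Finset.sum_filter, Finset.filter_mem_eq_inter, Finset.inter_eq_right.2 hW, Finset.mul_sum]

/-- Here `rate` is evaluated at raw degrees instead of proportions; `rate_div` converts between the
two by homogeneity of degree `-1`. -/
theorem condMean_typeVertices (a : Fin K) :
    condMean (stepSupport K n₀) (stepProb π κ G₀ a₀) n
      (fun s => if s.2 ∈ typeVertices a₀ x n a then 1 else 0) x =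
      typeDeg G₀ a₀ x n a * rate π κ (typeDeg G₀ a₀ x n) a := by
  rw [condMean_target (typeVertices_subset a), rate, Finset.mul_sum]
  refine Finset.sum_congr rfl fun b _ => ?_
  rw [sum_attachProb_typeVertices]
  ring

theorem degVertices_subset (a : Fin K) (k : ℕ) :
    degVertices G₀ a₀ x n a k ⊆ vertexSet n₀ n :=
  (Finset.filter_subset _ _).trans (typeVertices_subset a)

theorem condMean_degVertices (a : Fin K) (k : ℕ) :
    condMean (stepSupport K n₀) (stepProb π κ G₀ a₀) n
      (fun s => if s.2 ∈ degVertices G₀ a₀ x n a k then 1 else 0) x =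
      k * degCount G₀ a₀ x n a k * rate π κ (typeDeg G₀ a₀ x n) a := by
  rw [condMean_target (degVertices_subset a k), rate, Finset.mul_sum]
  refine Finset.sum_congr rfl fun b _ => ?_
  rw [sum_attachProb_degVertices]
  ring

end Steps

/-! ### Almost sure limits of averages -/

/-- Passing from `A n / n` to `A (n + 1) / (n + 1)` costs an extra `A n / n` in the drift, which is
the 1 added to `c`. -/
theorem tendsto_div_of_increments {A d β γ : ℕ → ℝ} {b c s : ℝ} (hc : 0 ≤ c)
    (hβ : Tendsto β atTop (𝓝 b)) (hγ : Tendsto γ atTop (𝓝 c))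
    (hd : Tendsto (fun n => ∑ i ∈ Finset.range n, d i / ((i : ℝ) + 1)) atTop (𝓝 s))
    (hA : ∀ᶠ n : ℕ in atTop, A (n + 1) = A n + (β n - γ n * (A n / n)) + d n) :
    Tendsto (fun n : ℕ => A n / n) atTop (𝓝 (b / (1 + c))) := by
  refine tendsto_of_affine_recursion (show 0 < 1 + c by linarith) (hγ.const_add 1) hβ hd ?_
  filter_upwards [hA, eventually_ge_atTop 1] with n hn h1
  have h0 : (0 : ℝ) < n := by exact_mod_cast h1
  push_cast
  rw [hn]
  field_simp
  ring

section Limits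

variable {K n₀ : ℕ} {Ω : Type*} [MeasurableSpace Ω] {μ : Measure Ω} [IsProbabilityMeasure μ]
  {π : Fin K → ℝ} {κ : Fin K → Fin K → ℝ} {G₀ : SimpleGraph (Fin n₀)} {a₀ : Fin n₀ → Fin K}
  {X : ℕ → Ω → Fin K × Vertex n₀}

/-- The exceptional null set depends on `f` only. The sequences and limits are quantified after the
almost sure statement, so they may depend on the trajectory. -/
theorem HasTransition.ae_tendsto_div {α : Type*} [MeasurableSpace α] [Countable α]
    [DiscreteMeasurableSpace α] [Nonempty α] {X : ℕ → Ω → α} {S : ℕ → Finset α}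
    {p : ℕ → (ℕ → α) → α → ℝ} (hX : HasTransition μ X S p) {f : ℕ → (ℕ → α) → α → ℝ} {C : ℝ}
    (hf : ∀ n, DependsOnPast n (f n)) (hC : ∀ n h s, |f n h s| ≤ C) :
    ∀ᵐ ω ∂μ, ∀ (A β γ : ℕ → ℝ) (b c : ℝ), 0 ≤ c → Tendsto β atTop (𝓝 b) →
      Tendsto γ atTop (𝓝 c) → (∀ n, A (n + 1) = A n + f n (fun i => X i ω) (X n ω)) →
      (∀ᶠ n : ℕ in atTop, condMean S p n (f n fun i => X i ω) (fun i => X i ω) =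
        β n - γ n * (A n / n)) →
      Tendsto (fun n : ℕ => A n / n) atTop (𝓝 (b / (1 + c))) := by
  filter_upwards [hX.ae_tendsto_sum_centered hf hC] with ω ⟨s, hs⟩ A β γ b c hc hβ hγ hA hm
  refine tendsto_div_of_increments hc hβ hγ hs ?_
  filter_upwards [hm] with n hn
  rw [← hn, hA n]
  ring

theorem ae_isValid [Nonempty (Fin K × Vertex n₀)]
    (hX : HasTransition μ X (stepSupport K n₀) (stepProb π κ G₀ a₀)) :
    ∀ᵐ ω ∂μ, IsValid fun i => X i ω := by
  filter_upwards [ae_all_iff.2 hX.ae_mem] with ω hω n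
  exact (Finset.mem_product.1 (hω n)).2

theorem ae_tendsto_typeCount [Nonempty (Fin K × Vertex n₀)] (hκ : ∀ a b, 0 < κ a b)
    (hG₀ : G₀.Connected) (hX : HasTransition μ X (stepSupport K n₀) (stepProb π κ G₀ a₀))
    (a : Fin K) :
    ∀ᵐ ω ∂μ, Tendsto (fun n : ℕ => typeCount a₀ (fun i => X i ω) n a / n) atTop (𝓝 (π a)) := by
  filter_upwards [hX.ae_tendsto_div (f := fun _ _ s => if s.1 = a then 1 else 0) (C := 1)
    (fun _ _ _ _ => rfl) fun _ _ s => by split_ifs <;> simp] with ω hω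
  have := hω (fun n => typeCount a₀ (fun i => X i ω) n a) (fun _ => π a) (fun _ => 0) (π a) 0
    le_rfl tendsto_const_nhds tendsto_const_nhds (fun n => typeCount_succ a)
    (Eventually.of_forall fun n => by rw [condMean_attr hκ hG₀]; ring)
  simpa using this

end Limits

/-! ### Convergence of the degree proportions -/

/-- With `u = Δ / S`, `log (1 + u) ≥ u / (1 + u) ≥ u - u²`. The square becomes a summable error
since `S` grows linearly. -/
theorem sub_sq_le_log_sub_log {S Δ : ℝ} (hS : 0 < S) (hΔ : 0 ≤ Δ) :
    Δ / S - (Δ / S) ^ 2 ≤ Real.log (S + Δ) - Real.log S := by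
  have hu : 0 ≤ Δ / S := by positivity
  have h1 := Real.one_sub_inv_le_log_of_pos (show 0 < 1 + Δ / S by positivity)
  rw [← Real.log_div (by positivity) hS.ne', add_div, div_self hS.ne']
  refine le_trans ?_ h1
  rw [← sub_nonneg]
  have : 1 - (1 + Δ / S)⁻¹ - (Δ / S - (Δ / S) ^ 2) = (Δ / S) ^ 3 / (1 + Δ / S) := by
    field_simp
    ring
  rw [this]
  positivity

theorem log_add_sub_log_le {T d : ℝ} (hT : 0 < T) (hd : 0 ≤ d) :
    Real.log (T + d) - Real.log T ≤ d / T := by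
  rw [← Real.log_div (by positivity) hT.ne', add_div, div_self hT.ne']
  have := Real.log_le_sub_one_of_pos (show 0 < 1 + d / T by positivity)
  linarith

section DegreeProportions

variable {K n₀ : ℕ} {π : Fin K → ℝ} {κ : Fin K → Fin K → ℝ} {G₀ : SimpleGraph (Fin n₀)}
  {a₀ : Fin n₀ → Fin K} {x : History K n₀} {n : ℕ} {η : Fin K → ℝ}

theorem rate_div {S : Fin K → ℝ} {T : ℝ} (j : Fin K) :
    rate π κ (fun l => S l / T) j = T * rate π κ S j := by
  simp only [rate, Finset.mul_sum]
  refine Finset.sum_congr rfl fun b _ => ?_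
  rw [show ∑ l, κ l b * (S l / T) = (∑ l, κ l b * S l) / T by
    rw [Finset.sum_div]; exact Finset.sum_congr rfl fun l _ => by ring]
  rw [div_div_eq_mul_div]
  ring

/-- One step of the relative entropy, expressed through the degrees `S` and their increments. -/
theorem entropy_step {S Δ : Fin K → ℝ} {T : ℝ} (hη : η ∈ openSimplex K) (hS : ∀ j, 0 < S j)
    (hT : 0 < T) (hΔ : ∀ j, 0 ≤ Δ j) (hΔ2 : ∀ j, Δ j ≤ 2) :
    -∑ j, η j * Real.log ((S j + Δ j) / (T + 2)) ≤ -∑ j, η j * Real.log (S j / T) -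
      (∑ j, η j * (π j / (S j / T) + rate π κ (fun l => S l / T) j) - 2) / T -
      ∑ j, η j / S j * (Δ j - (π j + S j * rate π κ S j)) + 4 * ∑ j, η j * (1 / S j) ^ 2 := by
  have e1 : ∑ j, η j * Real.log ((S j + Δ j) / (T + 2)) =
      ∑ j, η j * Real.log (S j + Δ j) - Real.log (T + 2) := by
    have : ∀ j, η j * Real.log ((S j + Δ j) / (T + 2)) =
        η j * Real.log (S j + Δ j) - η j * Real.log (T + 2) := fun j => by
      have := hS j
      have := hΔ j
      rw [Real.log_div (by positivity) (by positivity)]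
      ring
    simp only [this, Finset.sum_sub_distrib, ← Finset.sum_mul, hη.2, one_mul]
  have e2 : ∑ j, η j * Real.log (S j / T) = ∑ j, η j * Real.log (S j) - Real.log T := by
    have : ∀ j, η j * Real.log (S j / T) = η j * Real.log (S j) - η j * Real.log T := fun j => by
      rw [Real.log_div (hS j).ne' hT.ne']
      ring
    simp only [this, Finset.sum_sub_distrib, ← Finset.sum_mul, hη.2, one_mul]
  have e3 : (∑ j, η j * (π j / (S j / T) + rate π κ (fun l => S l / T) j) - 2) / T =
      ∑ j, η j / S j * (π j + S j * rate π κ S j) - 2 / T := by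
    rw [sub_div, Finset.sum_div]
    congr 1
    refine Finset.sum_congr rfl fun j _ => ?_
    have := (hS j).ne'
    rw [rate_div]
    field_simp
  have h4 : ∑ j, (η j / S j * Δ j - 4 * (η j * (1 / S j) ^ 2)) ≤
      ∑ j, (η j * Real.log (S j + Δ j) - η j * Real.log (S j)) := by
    refine Finset.sum_le_sum fun j _ => ?_
    have hSj := hS j
    have hηj := hη.1 j
    have h1 := mul_le_mul_of_nonneg_left (sub_sq_le_log_sub_log hSj (hΔ j)) hηj.le
    have h2 : (Δ j / S j) ^ 2 ≤ 4 * (1 / S j) ^ 2 := by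
      rw [div_eq_mul_one_div, mul_pow]
      -- One step can raise the degree of a type by 2, when newcomer and target share it; this is
      -- the source of the constant 4.
      have : Δ j ^ 2 ≤ 4 := by nlinarith [hΔ j, hΔ2 j]
      gcongr
    have h3 := mul_le_mul_of_nonneg_left h2 hηj.le
    have e : η j / S j * Δ j = η j * (Δ j / S j) := by ring
    rw [e]
    linarith
  have h5 := log_add_sub_log_le hT zero_le_two
  have e6 : ∑ j, η j / S j * (Δ j - (π j + S j * rate π κ S j)) =
      ∑ j, η j / S j * Δ j - ∑ j, η j / S j * (π j + S j * rate π κ S j) := by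
    simp only [mul_sub, Finset.sum_sub_distrib]
  rw [Finset.sum_sub_distrib, Finset.sum_sub_distrib, ← Finset.mul_sum] at h4
  rw [e1, e2, e3, e6]
  linarith

/-- Every newcomer contributes at least 1 to the degree of its type. By the law of large numbers for
attributes, the degree proportions thus stay away from the boundary of the simplex. -/
theorem typeCount_sub_le_typeDeg (hx : IsValid x) (a : Fin K) :
    typeCount a₀ x n a - typeCount a₀ x 0 a ≤ typeDeg G₀ a₀ x n a := by
  induction n with
  | zero => simpa using typeDeg_nonneg a
  | succ n ih =>
    rw [typeCount_succ, typeDeg_succ hx]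
    have : (0 : ℝ) ≤ if (x n).2 ∈ typeVertices a₀ x n a then 1 else 0 := by split_ifs <;> simp
    linarith

/-- The increment of the total degree of type `j` caused by the growth step `s`. -/
noncomputable def degIncrement (a₀ : Fin n₀ → Fin K) (n : ℕ) (x : History K n₀) (j : Fin K)
    (s : Fin K × Vertex n₀) : ℝ :=
  (if s.2 ∈ typeVertices a₀ x n j then 1 else 0) + if s.1 = j then 1 else 0

theorem degIncrement_nonneg (j : Fin K) (s : Fin K × Vertex n₀) : 0 ≤ degIncrement a₀ n x j s := by
  rw [degIncrement]
  split_ifs <;> norm_num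

theorem degIncrement_le_two (j : Fin K) (s : Fin K × Vertex n₀) :
    degIncrement a₀ n x j s ≤ 2 := by
  rw [degIncrement]
  split_ifs <;> norm_num

/-- A bounded predictable weight that agrees with `(n + 1) / S_n(j)` as soon as
`S_n(j) ≥ (π_j / 2) (n + 1)`. -/
noncomputable def entropyWeight (π : Fin K → ℝ) (G₀ : SimpleGraph (Fin n₀))
    (a₀ : Fin n₀ → Fin K) (n : ℕ) (x : History K n₀) (j : Fin K) : ℝ :=
  ((n : ℝ) + 1) / max (typeDeg G₀ a₀ x n j) (π j / 2 * (n + 1))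

theorem entropyWeight_nonneg (hπ : ∀ a, 0 < π a) (j : Fin K) :
    0 ≤ entropyWeight π G₀ a₀ n x j := by
  have := hπ j
  have : 0 ≤ max (typeDeg G₀ a₀ x n j) (π j / 2 * (n + 1)) := le_max_of_le_right (by positivity)
  unfold entropyWeight
  positivity

theorem entropyWeight_le (hπ : ∀ a, 0 < π a) (j : Fin K) :
    entropyWeight π G₀ a₀ n x j ≤ 2 / π j := by
  have h := hπ j
  have h1 : (0 : ℝ) < π j / 2 * (n + 1) := by positivity
  calc entropyWeight π G₀ a₀ n x j ≤ ((n : ℝ) + 1) / (π j / 2 * (n + 1)) := by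
        unfold entropyWeight
        gcongr
        exact le_max_right _ _
    _ = 2 / π j := by field_simp

/-- The entropy increment to first order. -/
noncomputable def entropyIncrement (π : Fin K → ℝ) (G₀ : SimpleGraph (Fin n₀))
    (a₀ : Fin n₀ → Fin K) (η : Fin K → ℝ) (n : ℕ) (x : History K n₀)
    (s : Fin K × Vertex n₀) : ℝ :=
  ∑ j, η j * entropyWeight π G₀ a₀ n x j * degIncrement a₀ n x j s

theorem entropyIncrement_past (n : ℕ) : DependsOnPast n (entropyIncrement π G₀ a₀ η n) := by
  intro h h' hh
  funext s
  simp only [entropyIncrement, entropyWeight, degIncrement, typeDeg_congr hh,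
    typeVertices_congr hh]

theorem abs_entropyIncrement_le (hπ : ∀ a, 0 < π a) (hη : η ∈ openSimplex K)
    (s : Fin K × Vertex n₀) :
    |entropyIncrement π G₀ a₀ η n x s| ≤ ∑ j, η j * (2 / π j) * 2 := by
  rw [entropyIncrement, abs_of_nonneg (Finset.sum_nonneg fun j _ => mul_nonneg
    (mul_nonneg (hη.1 j).le (entropyWeight_nonneg hπ j)) (degIncrement_nonneg j s))]
  refine Finset.sum_le_sum fun j _ => ?_
  have := hη.1 j
  have := hπ j
  have := entropyWeight_nonneg (n := n) (x := x) (G₀ := G₀) (a₀ := a₀) hπ j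
  have := degIncrement_nonneg (n := n) (x := x) (a₀ := a₀) j s
  gcongr
  · exact entropyWeight_le hπ j
  · exact degIncrement_le_two j s

theorem condMean_entropyIncrement (hκ : ∀ a b, 0 < κ a b) (hG₀ : G₀.Connected) :
    condMean (stepSupport K n₀) (stepProb π κ G₀ a₀) n (entropyIncrement π G₀ a₀ η n x) x =
      ∑ j, η j * entropyWeight π G₀ a₀ n x j *
        (π j + typeDeg G₀ a₀ x n j * rate π κ (typeDeg G₀ a₀ x n) j) := by
  have h := condMean_sum_mul (π := π) (κ := κ) (G₀ := G₀) (a₀ := a₀) (n := n) (x := x)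
    (fun j => η j * entropyWeight π G₀ a₀ n x j) fun j => degIncrement a₀ n x j
  refine h.trans (Finset.sum_congr rfl fun j _ => ?_)
  have := condMean_add (π := π) (κ := κ) (G₀ := G₀) (a₀ := a₀) (n := n) (x := x)
    (fun s => if s.2 ∈ typeVertices a₀ x n j then 1 else 0) fun s => if s.1 = j then 1 else 0
  rw [condMean_typeVertices, condMean_attr hκ hG₀] at this
  rw [add_comm (π j), ← this]
  rfl

/-- The degree proportions converge to the minimizer along every valid trajectory for which the
attribute frequencies and the entropy noise behave as they do almost surely. -/
theorem tendsto_degree_proportion (hπ : ∀ a, 0 < π a) (hπ_sum : ∑ a, π a = 1)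
    (hκ : ∀ a b, 0 < κ a b) (hG₀ : G₀.Connected) (hη : η ∈ openSimplex K)
    (hcrit : ∀ j, π j / η j + phi π κ η j = 2) (hx : IsValid x)
    (hcount : ∀ j, Tendsto (fun n : ℕ => typeCount a₀ x n j / n) atTop (𝓝 (π j))) {s : ℝ}
    (hnoise : Tendsto (fun n => ∑ i ∈ Finset.range n, (entropyIncrement π G₀ a₀ η i x (x i) -
      condMean (stepSupport K n₀) (stepProb π κ G₀ a₀) i (entropyIncrement π G₀ a₀ η i x) x) /
        ((i : ℝ) + 1)) atTop (𝓝 s)) (j : Fin K) :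
    Tendsto (fun n => typeDeg G₀ a₀ x n j / ∑ l, typeDeg G₀ a₀ x n l) atTop (𝓝 (η j)) := by
  have := nonempty_fin_of_sum_eq_one hπ_sum
  set S : ℕ → Fin K → ℝ := fun n => typeDeg G₀ a₀ x n with hS
  set T : ℕ → ℝ := fun n => ∑ l, S n l with hT
  set Y : ℕ → Fin K → ℝ := fun n l => S n l / T n with hY
  set T₀ := T 0 with hT₀
  have hT₀pos : 0 < T₀ := totalDeg_zero_pos hG₀
  have hTn : ∀ n, T n = 2 * n + T₀ := fun n => totalDeg_eq hx
  have hTpos : ∀ n, 0 < T n := fun n => by rw [hTn]; positivity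
  have hSlow : ∀ᶠ n : ℕ in atTop, ∀ l, π l / 2 * ((n : ℝ) + 1) ≤ S n l := by
    refine eventually_all.2 fun l => ?_
    have h1 : Tendsto (fun n : ℕ => typeCount a₀ x n l / n - typeCount a₀ x 0 l / n -
        π l / 2 * (1 / (n : ℝ))) atTop (𝓝 (π l - 0 - π l / 2 * 0)) :=
      ((hcount l).sub (tendsto_const_div_atTop_nhds_zero_nat _)).sub
        (tendsto_one_div_atTop_nhds_zero_nat.const_mul _)
    filter_upwards [h1.eventually (lt_mem_nhds (show π l / 2 < π l - 0 - π l / 2 * 0 by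
      linarith [hπ l])), eventually_ge_atTop 1] with n hn hn1
    have hn0 : (0 : ℝ) < n := by exact_mod_cast hn1
    refine le_trans ?_ (typeCount_sub_le_typeDeg hx l)
    have := mul_lt_mul_of_pos_right hn hn0
    have e : (typeCount a₀ x n l / n - typeCount a₀ x 0 l / n - π l / 2 * (1 / (n : ℝ))) * n =
        typeCount a₀ x n l - typeCount a₀ x 0 l - π l / 2 := by
      field_simp
    linarith
  have hSpos : ∀ᶠ n : ℕ in atTop, ∀ l, 0 < S n l := by
    filter_upwards [hSlow] with n hn l
    exact lt_of_lt_of_le (by have := hπ l; positivity) (hn l)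
  have hYmem : ∀ᶠ n in atTop, Y n ∈ openSimplex K := by
    filter_upwards [hSpos] with n hn
    refine ⟨fun l => div_pos (hn l) (hTpos n), ?_⟩
    simp only [hY, ← Finset.sum_div]
    exact div_self (hTpos n).ne'
  set L : ℕ → ℝ := fun n => -∑ l, η l * Real.log (Y n l) with hL
  -- The factor `(n + 1) / T n` converts steps `1 / T n` into the steps `1 / (n + 1)` of
  -- `robbins_siegmund`; it is bounded below by `1 / (2 + T₀)`.
  set g : ℕ → ℝ := fun n => ((n : ℝ) + 1) *
    ((∑ l, η l * (π l / Y n l + rate π κ (Y n) l) - 2) / T n) with hg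
  set q : ℕ → ℝ := fun n => ∑ l, π l * (Y n l - η l) ^ 2 with hq
  -- Minus the martingale noise plus the quadratic error of the logarithm. Both use the truncated
  -- weights, so the series converges regardless of when the lower bound on `S` sets in.
  set ε : ℕ → ℝ := fun n => -((entropyIncrement π G₀ a₀ η n x (x n) -
      condMean (stepSupport K n₀) (stepProb π κ G₀ a₀) n (entropyIncrement π G₀ a₀ η n x) x) /
        ((n : ℝ) + 1)) + 4 * ∑ l, η l * (entropyWeight π G₀ a₀ n x l / ((n : ℝ) + 1)) ^ 2 with hε
  have hεconv : ∃ t, Tendsto (fun n => ∑ i ∈ Finset.range n, ε i) atTop (𝓝 t) := by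
    have hsq : Summable fun n : ℕ => ∑ l, η l *
        (entropyWeight π G₀ a₀ n x l / ((n : ℝ) + 1)) ^ 2 := by
      refine summable_sum fun l _ => Summable.mul_left _ ?_
      have h2 : Summable fun i : ℕ => (2 / π l) ^ 2 * (1 / ((i : ℝ) + 1) ^ 2) := by
        have := (summable_nat_add_iff 1).2 (Real.summable_one_div_nat_pow.2 one_lt_two)
        exact Summable.mul_left _ (by simpa using this)
      refine h2.of_nonneg_of_le (fun n => sq_nonneg _) fun n => ?_
      have h0 := entropyWeight_nonneg (n := n) (x := x) (G₀ := G₀) (a₀ := a₀) hπ l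
      have h1 := entropyWeight_le (n := n) (x := x) (G₀ := G₀) (a₀ := a₀) hπ l
      rw [div_pow, mul_one_div]
      gcongr
    refine ⟨_, (hnoise.neg.add (hsq.hasSum.tendsto_sum_nat.const_mul 4)).congr fun n => ?_⟩
    simp only [hε, Finset.sum_add_distrib, Finset.sum_neg_distrib, Finset.mul_sum]
  obtain ⟨t, ht⟩ := hεconv
  have hqg : ∀ᶠ n in atTop, q n / (2 + T₀) ≤ g n := by
    filter_upwards [hYmem] with n hn
    have h1 : q n ≤ ∑ l, η l * (π l / Y n l + rate π κ (Y n) l) - 2 :=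
      sum_sq_le_entropy_drift hπ hπ_sum hκ hη hcrit hn
    have h0 : 0 ≤ q n := Finset.sum_nonneg fun l _ => mul_nonneg (hπ l).le (sq_nonneg _)
    have h2 : T n ≤ (2 + T₀) * (n + 1) := by
      rw [hTn]
      have : 0 ≤ T₀ * n := by positivity
      nlinarith
    have := hTpos n
    calc q n / (2 + T₀) = ((n : ℝ) + 1) * (q n / ((2 + T₀) * (n + 1))) := by field_simp
      _ ≤ g n := by
        simp only [hg]
        exact mul_le_mul_of_nonneg_left
          (div_le_div₀ (h0.trans h1) h1 this h2) (by positivity)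
  have hq0 : ∀ n, 0 ≤ q n := fun n =>
    Finset.sum_nonneg fun l _ => mul_nonneg (hπ l).le (sq_nonneg _)
  have hstep : ∀ᶠ n : ℕ in atTop, L (n + 1) ≤ L n - g n / (n + 1) + ε n := by
    filter_upwards [hSpos, hSlow] with n hn hlow
    have h1 := entropy_step (π := π) (κ := κ) (S := S n) (T := T n)
      (Δ := fun l => degIncrement a₀ n x l (x n)) hη hn (hTpos n)
      (fun l => degIncrement_nonneg l _) fun l => degIncrement_le_two l _
    have hS1 : ∀ l, S (n + 1) l = S n l + degIncrement a₀ n x l (x n) := fun l => by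
      simp only [hS, typeDeg_succ hx, degIncrement]
      ring
    have hT1 : T (n + 1) = T n + 2 := by
      rw [hTn, hTn]
      push_cast
      ring
    have hw : ∀ l, entropyWeight π G₀ a₀ n x l / ((n : ℝ) + 1) = 1 / S n l := fun l => by
      rw [entropyWeight, max_eq_left (hlow l), div_div_cancel_left']
      · simp [hS]
      · positivity
    have hgn : g n / ((n : ℝ) + 1) =
        (∑ l, η l * (π l / Y n l + rate π κ (Y n) l) - 2) / T n := by
      simp only [hg]
      field_simp
    have hεn : ε n = -∑ l, η l / S n l * (degIncrement a₀ n x l (x n) -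
        (π l + S n l * rate π κ (S n) l)) + 4 * ∑ l, η l * (1 / S n l) ^ 2 := by
      simp only [hε, condMean_entropyIncrement hκ hG₀, entropyIncrement, hw]
      rw [← Finset.sum_sub_distrib, Finset.sum_div]
      congr 2
      refine Finset.sum_congr rfl fun l _ => ?_
      rw [show η l / S n l = η l * (entropyWeight π G₀ a₀ n x l / ((n : ℝ) + 1)) by
        rw [hw, mul_one_div]]
      ring
    have hL1 : L (n + 1) = -∑ l, η l * Real.log ((S n l + degIncrement a₀ n x l (x n)) /
        (T n + 2)) := by
      simp only [hL, hY, hS1, hT1]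
    rw [hL1, hgn, hεn]
    refine h1.trans (le_of_eq ?_)
    simp only [hL, hY]
    ring
  have hLnn : ∀ᶠ n in atTop, 0 ≤ L n := by
    filter_upwards [hYmem] with n hn
    have : ∑ l, η l * Real.log (Y n l) ≤ 0 := Finset.sum_nonpos fun l _ =>
      mul_nonpos_of_nonneg_of_nonpos (hη.1 l).le (Real.log_nonpos (hn.1 l).le
        (hn.2 ▸ Finset.single_le_sum (fun i _ => (hn.1 i).le) (Finset.mem_univ l)))
    simp only [hL]
    linarith
  have hgnn : ∀ᶠ n in atTop, 0 ≤ g n := by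
    filter_upwards [hqg] with n hn
    exact le_trans (div_nonneg (hq0 n) (by linarith)) hn
  obtain ⟨⟨l₀, hl₀⟩, hfreq⟩ := robbins_siegmund hLnn hgnn ht hstep
  have hqfreq : ∀ k : ℕ, ∃ᶠ n in atTop, q n < 1 / ((k : ℝ) + 1) := by
    intro k
    refine ((hfreq (1 / ((k : ℝ) + 1) / (2 + T₀)) (by positivity)).and_eventually hqg).mono ?_
    rintro n ⟨h1, h2⟩
    exact (div_lt_div_iff_of_pos_right (by linarith)).1 (h2.trans_lt h1)
  -- Along this subsequence the proportions tend to `η`. As the full sequence `L` already converges,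
  -- its limit must be the entropy of `η`.
  obtain ⟨ψ, hψ, hψq⟩ := extraction_forall_of_frequently hqfreq
  have hqψ : Tendsto (fun k => q (ψ k)) atTop (𝓝 0) :=
    squeeze_zero (fun k => hq0 _) (fun k => (hψq k).le) tendsto_one_div_add_atTop_nhds_zero_nat
  have hYψ : ∀ l, Tendsto (fun k => Y (ψ k) l) atTop (𝓝 (η l)) := by
    intro l
    have h1 : Tendsto (fun k => (Y (ψ k) l - η l) ^ 2) atTop (𝓝 0) := by
      refine squeeze_zero (fun k => sq_nonneg _) (fun k => ?_)
        (by simpa using hqψ.div_const (π l))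
      rw [le_div_iff₀ (hπ l), mul_comm]
      exact Finset.single_le_sum (f := fun l => π l * (Y (ψ k) l - η l) ^ 2)
        (fun i _ => mul_nonneg (hπ i).le (sq_nonneg _)) (Finset.mem_univ l)
    have h2 := h1.sqrt
    simp only [Real.sqrt_sq_eq_abs, Real.sqrt_zero] at h2
    have h3 := (tendsto_zero_iff_abs_tendsto_zero _).2 h2
    simpa using h3.add_const (η l)
  have hLψ : Tendsto (fun k => L (ψ k)) atTop (𝓝 (-∑ l, η l * Real.log (η l))) :=
    (tendsto_finsetSum _ fun l _ => ((hYψ l).log (hη.1 l).ne').const_mul _).neg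
  have hl : l₀ = -∑ l, η l * Real.log (η l) :=
    tendsto_nhds_unique (hl₀.comp hψ.tendsto_atTop) hLψ
  have hell : Tendsto (fun n => (√(Y n j) - √(η j)) ^ 2) atTop (𝓝 0) := by
    have h0 : Tendsto (fun n => L n - -∑ l, η l * Real.log (η l)) atTop (𝓝 0) := by
      simpa [hl] using hl₀.sub_const (-∑ l, η l * Real.log (η l))
    refine squeeze_zero' (Eventually.of_forall fun n => sq_nonneg _) ?_ h0
    filter_upwards [hYmem] with n hn
    exact (Finset.single_le_sum (f := fun l => (√(Y n l) - √(η l)) ^ 2)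
      (fun i _ => sq_nonneg _) (Finset.mem_univ j)).trans (hellinger_le_entropy hη hn)
  have h2 := hell.sqrt
  simp only [Real.sqrt_sq_eq_abs, Real.sqrt_zero] at h2
  have h3 := (((tendsto_zero_iff_abs_tendsto_zero _).2 h2).add_const (√(η j))).pow 2
  simp only [sub_add_cancel, zero_add, Real.sq_sqrt (hη.1 j).le] at h3
  refine h3.congr' ?_
  filter_upwards [hYmem] with n hn
  exact Real.sq_sqrt (hn.1 j).le

end DegreeProportions

/-! ### Limits of the network statistics -/

section Statistics

variable {K n₀ : ℕ} {Ω : Type*} [MeasurableSpace Ω] {μ : Measure Ω} [IsProbabilityMeasure μ]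
  {π : Fin K → ℝ} {κ : Fin K → Fin K → ℝ} {G₀ : SimpleGraph (Fin n₀)} {a₀ : Fin n₀ → Fin K}
  {X : ℕ → Ω → Fin K × Vertex n₀} {x : History K n₀} {η : Fin K → ℝ}

theorem ae_tendsto_typeDeg [Nonempty (Fin K × Vertex n₀)] (hπ : ∀ a, 0 < π a)
    (hπ_sum : ∑ a, π a = 1) (hκ : ∀ a b, 0 < κ a b) (hG₀ : G₀.Connected)
    (hη : η ∈ openSimplex K) (hcrit : ∀ j, π j / η j + phi π κ η j = 2)
    (hX : HasTransition μ X (stepSupport K n₀) (stepProb π κ G₀ a₀)) :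
    ∀ᵐ ω ∂μ, ∀ j, Tendsto (fun n : ℕ => typeDeg G₀ a₀ (fun i => X i ω) n j / n) atTop
      (𝓝 (2 * η j)) := by
  filter_upwards [ae_isValid hX, ae_all_iff.2 fun a => ae_tendsto_typeCount hκ hG₀ hX a,
    hX.ae_tendsto_sum_centered (f := entropyIncrement π G₀ a₀ η)
      (C := ∑ j, η j * (2 / π j) * 2) entropyIncrement_past
      fun n h s => abs_entropyIncrement_le hπ hη s] with ω hx hcount ⟨s, hs⟩ j
  have h1 := tendsto_degree_proportion hπ hπ_sum hκ hG₀ hη hcrit hx hcount hs j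
  have h2 : Tendsto (fun n : ℕ => (∑ l, typeDeg G₀ a₀ (fun i => X i ω) n l) / n) atTop (𝓝 2) := by
    have h3 := (tendsto_const_div_atTop_nhds_zero_nat
      (∑ l, typeDeg G₀ a₀ (fun i => X i ω) 0 l)).const_add 2
    rw [add_zero] at h3
    refine h3.congr' ?_
    filter_upwards [eventually_ge_atTop 1] with n hn
    have : (0 : ℝ) < n := by exact_mod_cast hn
    rw [totalDeg_eq hx (n := n)]
    field_simp
  rw [mul_comm]
  refine (h1.mul h2).congr fun n => ?_
  have hT : 0 < ∑ l, typeDeg G₀ a₀ (fun i => X i ω) n l := by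
    rw [totalDeg_eq hx]
    have := totalDeg_zero_pos (a₀ := a₀) (x := fun i => X i ω) hG₀
    positivity
  rw [div_mul_div_cancel₀ hT.ne']

theorem tendsto_weight_div
    (hdeg : ∀ j, Tendsto (fun n : ℕ => typeDeg G₀ a₀ x n j / n) atTop (𝓝 (2 * η j)))
    (b : Fin K) :
    Tendsto (fun n : ℕ => (∑ l, κ l b * typeDeg G₀ a₀ x n l) / n) atTop
      (𝓝 (2 * ∑ l, κ l b * η l)) := by
  have : Tendsto (fun n : ℕ => ∑ l, κ l b * (typeDeg G₀ a₀ x n l / n)) atTop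
      (𝓝 (∑ l, κ l b * (2 * η l))) := tendsto_finsetSum _ fun l _ => (hdeg l).const_mul _
  rw [Finset.mul_sum]
  simp only [Finset.sum_div, ← mul_div_assoc, mul_left_comm (2 : ℝ)] at this ⊢
  exact this

theorem tendsto_mul_rate [Nonempty (Fin K)] (hκ : ∀ a b, 0 < κ a b) (hη : η ∈ openSimplex K)
    (hdeg : ∀ j, Tendsto (fun n : ℕ => typeDeg G₀ a₀ x n j / n) atTop (𝓝 (2 * η j)))
    (a : Fin K) :
    Tendsto (fun n : ℕ => n * rate π κ (typeDeg G₀ a₀ x n) a) atTop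
      (𝓝 (phi π κ η a / 2)) := by
  have h : Tendsto (fun n : ℕ => ∑ b, π b * κ a b / ((∑ l, κ l b * typeDeg G₀ a₀ x n l) / n))
      atTop (𝓝 (∑ b, π b * κ a b / (2 * ∑ l, κ l b * η l))) :=
    tendsto_finsetSum _ fun b _ => tendsto_const_nhds.div (tendsto_weight_div hdeg b)
      (mul_pos two_pos (sum_mul_pos hκ hη.1 b)).ne'
  have e : phi π κ η a / 2 = ∑ b, π b * κ a b / (2 * ∑ l, κ l b * η l) := by
    rw [phi_eq_rate, rate, Finset.sum_div]
    exact Finset.sum_congr rfl fun b _ => by rw [div_div, mul_comm 2]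
  rw [e]
  refine h.congr fun n => ?_
  simp only [rate, Finset.mul_sum, div_div_eq_mul_div]
  exact Finset.sum_congr rfl fun b _ => by ring

theorem abs_ite_sub_ite_add_ite_le (p q r : Prop) [Decidable p] [Decidable q] [Decidable r] :
    |(((if p then 1 else 0) - (if q then 1 else 0)) + if r then 1 else 0 : ℝ)| ≤ 2 := by
  split_ifs <;> norm_num

theorem ae_tendsto_degCount [Nonempty (Fin K × Vertex n₀)] (hπ : ∀ a, 0 < π a)
    (hπ_sum : ∑ a, π a = 1) (hκ : ∀ a b, 0 < κ a b) (hG₀ : G₀.Connected)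
    (hη : η ∈ openSimplex K) (hcrit : ∀ j, π j / η j + phi π κ η j = 2)
    (hX : HasTransition μ X (stepSupport K n₀) (stepProb π κ G₀ a₀)) (a : Fin K) :
    ∀ᵐ ω ∂μ, ∀ k : ℕ, Tendsto
      (fun n : ℕ => degCount G₀ a₀ (fun i => X i ω) n a (k + 1) / n) atTop
      (𝓝 (π a * limitDegree (phi π κ η a) (k + 1))) := by
  have := nonempty_fin_of_sum_eq_one hπ_sum
  have hφ : 0 < phi π κ η a := by rw [phi_eq_rate]; exact rate_pos hπ hκ hη.1 a
  filter_upwards [ae_isValid hX, ae_tendsto_typeDeg hπ hπ_sum hκ hG₀ hη hcrit hX,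
    ae_all_iff.2 fun k : ℕ => hX.ae_tendsto_div (C := 2)
      (f := fun n x s => ((if s.2 ∈ degVertices G₀ a₀ x n a k then 1 else 0) -
        (if s.2 ∈ degVertices G₀ a₀ x n a (k + 1) then 1 else 0)) +
        if s.1 = a ∧ k = 0 then 1 else 0)
      (fun n h h' hh => by simp only [degVertices_congr hh])
      fun n h s => abs_ite_sub_ite_add_ite_le _ _ _] with ω hx hdeg hω k
  have hr := tendsto_mul_rate (π := π) hκ hη hdeg a
  have hmean : ∀ (k n : ℕ), condMean (stepSupport K n₀) (stepProb π κ G₀ a₀) n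
      (fun s => ((if s.2 ∈ degVertices G₀ a₀ (fun i => X i ω) n a k then 1 else 0) -
        (if s.2 ∈ degVertices G₀ a₀ (fun i => X i ω) n a (k + 1) then 1 else 0)) +
        if s.1 = a ∧ k = 0 then 1 else 0) (fun i => X i ω) =
      (k * degCount G₀ a₀ (fun i => X i ω) n a k -
        (k + 1) * degCount G₀ a₀ (fun i => X i ω) n a (k + 1)) *
        rate π κ (typeDeg G₀ a₀ (fun i => X i ω) n) a + if k = 0 then π a else 0 := by
    intro k n
    rw [condMean_add, condMean_sub, condMean_degVertices, condMean_degVertices]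
    have : condMean (stepSupport K n₀) (stepProb π κ G₀ a₀) n
        (fun s => if s.1 = a ∧ k = 0 then 1 else 0) (fun i => X i ω) =
        if k = 0 then π a else 0 := by
      by_cases hk : k = 0
      · simp only [hk, and_true, if_true]
        exact condMean_attr hκ hG₀ a
      · simp [hk, condMean]
    rw [this]
    push_cast
    ring
  set N : ℕ → ℕ → ℝ := fun k n => degCount G₀ a₀ (fun i => X i ω) n a k with hN
  set r : ℕ → ℝ := fun n => n * rate π κ (typeDeg G₀ a₀ (fun i => X i ω) n) a with hr_def
  -- The hypothesis concerns `k * (N k n / n)`, so at `k = 0` it is trivial with `l = 0` and the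
  -- induction starts without information on vertices of degree 0.
  have hstep : ∀ (k : ℕ) (l : ℝ), Tendsto (fun n : ℕ => k * (N k n / n)) atTop (𝓝 l) →
      Tendsto (fun n : ℕ => N (k + 1) n / n) atTop
        (𝓝 ((phi π κ η a / 2 * l + if k = 0 then π a else 0) /
          (1 + (k + 1) * (phi π κ η a / 2)))) := by
    intro k l hl
    refine hω k (N (k + 1)) (fun n => r n * (k * (N k n / n)) + if k = 0 then π a else 0)
      (fun n => (k + 1) * r n) _ _ (by positivity) ((hr.mul hl).add_const _) (hr.const_mul _)
      (fun n => ?_) ?_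
    · simp only [hN, degCount_succ hx]
      ring
    · filter_upwards [eventually_ge_atTop 1] with n hn
      have h0 : (n : ℝ) ≠ 0 := Nat.cast_ne_zero.2 (by omega)
      rw [hmean]
      simp only [hN, hr_def]
      field_simp
      ring
  induction k with
  | zero =>
    have := hstep 0 0 (by simp)
    simp only [mul_zero, if_true, zero_add, Nat.cast_zero, one_mul] at this
    rwa [limitDegree_one hφ, mul_one_div]
  | succ k ih =>
    have := hstep (k + 1) _ (ih.const_mul _)
    rw [if_neg k.succ_ne_zero, add_zero] at this
    rw [limitDegree_succ hφ (by omega)]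
    convert this using 2
    ring

theorem empDegree_eq (n : ℕ) (a : Fin K) (k : ℕ) :
    empDegree G₀ a₀ x n a k = degCount G₀ a₀ x n a k / typeCount a₀ x n a := rfl

theorem ae_tendsto_empDegree [Nonempty (Fin K × Vertex n₀)] (hπ : ∀ a, 0 < π a)
    (hπ_sum : ∑ a, π a = 1) (hκ : ∀ a b, 0 < κ a b) (hG₀ : G₀.Connected)
    (hη : η ∈ openSimplex K) (hcrit : ∀ j, π j / η j + phi π κ η j = 2)
    (hX : HasTransition μ X (stepSupport K n₀) (stepProb π κ G₀ a₀)) (a : Fin K) :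
    ∀ᵐ ω ∂μ, ∀ k : ℕ, 1 ≤ k → Tendsto (fun n : ℕ => empDegree G₀ a₀ (fun i => X i ω) n a k) atTop
      (𝓝 (limitDegree (phi π κ η a) k)) := by
  filter_upwards [ae_tendsto_degCount hπ hπ_sum hκ hG₀ hη hcrit hX a,
    ae_tendsto_typeCount hκ hG₀ hX a] with ω h1 h2 k hk
  obtain ⟨k, rfl⟩ := Nat.exists_eq_add_of_le' hk
  have h3 := (h1 k).div h2 (hπ a).ne'
  rw [mul_div_cancel_left₀ _ (hπ a).ne'] at h3
  refine h3.congr' ?_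
  filter_upwards [eventually_ge_atTop 1] with n hn
  have h0 : (n : ℝ) ≠ 0 := Nat.cast_ne_zero.2 (by omega)
  rw [Pi.div_apply, empDegree_eq, div_div_div_cancel_right₀ h0]

/-- Criticality gives `2 - φ_a = π_a / η_a`, so the denominator of `M` cancels against `π_a`. -/
theorem meanMatrix_mul_eq (hη : η ∈ openSimplex K)
    (hcrit : ∀ j, π j / η j + phi π κ η j = 2) (hπ : ∀ a, 0 < π a) (a b : Fin K) :
    meanMatrix π κ η a b * π a = phi₂ π κ η a b * η a := by
  have h : 2 - phi π κ η a = π a / η a := by linarith [hcrit a]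
  have h1 := hη.1 a
  have h2 := hπ a
  rw [meanMatrix, Matrix.of_apply, h]
  field_simp

/-- The limiting probability that the next edge joins a newcomer of type `b` to a vertex of
type `a`. -/
theorem tendsto_condMean_edge [Nonempty (Fin K)] (hπ : ∀ a, 0 < π a) (hκ : ∀ a b, 0 < κ a b)
    (hη : η ∈ openSimplex K) (hcrit : ∀ j, π j / η j + phi π κ η j = 2)
    (hdeg : ∀ j, Tendsto (fun n : ℕ => typeDeg G₀ a₀ x n j / n) atTop (𝓝 (2 * η j)))
    (a b : Fin K) :
    Tendsto (fun n : ℕ => condMean (stepSupport K n₀) (stepProb π κ G₀ a₀) n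
      (fun s => if s.1 = b ∧ s.2 ∈ typeVertices a₀ x n a then 1 else 0) x) atTop
      (𝓝 (meanMatrix π κ η a b * π a)) := by
  have hpos := sum_mul_pos hκ hη.1 b
  have h := (((hdeg a).const_mul (κ a b)).div (tendsto_weight_div (κ := κ) hdeg b)
    (mul_pos two_pos hpos).ne').const_mul (π b)
  have e : π b * (κ a b * (2 * η a) / (2 * ∑ l, κ l b * η l)) = phi₂ π κ η a b * η a := by
    rw [phi₂, nu]
    field_simp
  rw [e] at h
  rw [meanMatrix_mul_eq hη hcrit hπ]
  refine h.congr' ?_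
  filter_upwards [eventually_ge_atTop 1] with n hn
  have h0 : (n : ℝ) ≠ 0 := Nat.cast_ne_zero.2 (by omega)
  rw [condMean_edge (typeVertices_subset a), sum_attachProb_typeVertices, Pi.div_apply]
  simp only [← mul_div_assoc]
  rw [div_div_div_cancel_right₀ h0]

theorem abs_ite_le_one (p : Prop) [Decidable p] : |(if p then 1 else 0 : ℝ)| ≤ 1 := by
  split_ifs <;> norm_num

theorem ae_tendsto_numEdges_self [Nonempty (Fin K × Vertex n₀)] (hπ : ∀ a, 0 < π a)
    (hπ_sum : ∑ a, π a = 1) (hκ : ∀ a b, 0 < κ a b) (hG₀ : G₀.Connected)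
    (hη : η ∈ openSimplex K) (hcrit : ∀ j, π j / η j + phi π κ η j = 2)
    (hX : HasTransition μ X (stepSupport K n₀) (stepProb π κ G₀ a₀)) (a : Fin K) :
    ∀ᵐ ω ∂μ, Tendsto (fun n : ℕ => (numEdges G₀ a₀ (fun i => X i ω) n a a : ℝ) / n) atTop
      (𝓝 (meanMatrix π κ η a a * π a)) := by
  have := nonempty_fin_of_sum_eq_one hπ_sum
  filter_upwards [ae_isValid hX, ae_tendsto_typeDeg hπ hπ_sum hκ hG₀ hη hcrit hX,
    hX.ae_tendsto_div (C := 1)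
      (f := fun n x s => if s.1 = a ∧ s.2 ∈ typeVertices a₀ x n a then 1 else 0)
      (fun n h h' hh => by simp only [typeVertices_congr hh])
      fun n h s => abs_ite_le_one _] with ω hx hdeg hω
  -- The count does not feed back on its own growth, so `γ = 0` and the limit is that of the
  -- conditional mean.
  have := hω (fun n => numEdges G₀ a₀ (fun i => X i ω) n a a) _ (fun _ => 0) _ 0 le_rfl
    (tendsto_condMean_edge hπ hκ hη hcrit hdeg a a) tendsto_const_nhds
    (fun n => numEdges_self_succ hx a) (Eventually.of_forall fun n => by ring)
  simpa using this

theorem ae_tendsto_numEdges_ne [Nonempty (Fin K × Vertex n₀)] (hπ : ∀ a, 0 < π a)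
    (hπ_sum : ∑ a, π a = 1) (hκ : ∀ a b, 0 < κ a b) (hG₀ : G₀.Connected)
    (hη : η ∈ openSimplex K) (hcrit : ∀ j, π j / η j + phi π κ η j = 2)
    (hX : HasTransition μ X (stepSupport K n₀) (stepProb π κ G₀ a₀)) {a b : Fin K}
    (hab : a ≠ b) :
    ∀ᵐ ω ∂μ, Tendsto (fun n : ℕ => (numEdges G₀ a₀ (fun i => X i ω) n a b : ℝ) / n) atTop
      (𝓝 (meanMatrix π κ η b a * π b + meanMatrix π κ η a b * π a)) := by
  have := nonempty_fin_of_sum_eq_one hπ_sum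
  filter_upwards [ae_isValid hX, ae_tendsto_typeDeg hπ hπ_sum hκ hG₀ hη hcrit hX,
    hX.ae_tendsto_div (C := 1 + 1)
      (f := fun n x s => (if s.1 = a ∧ s.2 ∈ typeVertices a₀ x n b then 1 else 0) +
        if s.1 = b ∧ s.2 ∈ typeVertices a₀ x n a then 1 else 0)
      (fun n h h' hh => by simp only [typeVertices_congr hh])
      fun n h s => (abs_add_le _ _).trans
        (add_le_add (abs_ite_le_one _) (abs_ite_le_one _))] with ω hx hdeg hω
  have := hω (fun n => numEdges G₀ a₀ (fun i => X i ω) n a b) _ (fun _ => 0) _ 0 le_rfl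
    ((tendsto_condMean_edge hπ hκ hη hcrit hdeg b a).add
      (tendsto_condMean_edge hπ hκ hη hcrit hdeg a b)) tendsto_const_nhds
    (fun n => numEdges_ne_succ hx hab)
    (Eventually.of_forall fun n => by rw [condMean_add]; ring)
  simpa using this

/-- The edge number is `n` plus a constant and `n.choose 2 = n (n - 1) / 2`, so the density behaves
like `2 / n`. -/
theorem tendsto_mul_edgeDensity (hx : IsValid x) :
    Tendsto (fun n : ℕ => (n : ℝ) * edgeDensity G₀ x n) atTop (𝓝 2) := by
  set e : ℝ := ((network G₀ x 0).edgeSet.ncard : ℝ) with he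
  have h : Tendsto (fun n : ℕ => 2 * (1 + e / n) / (1 - 1 / (n : ℝ))) atTop
      (𝓝 (2 * (1 + 0) / (1 - 0))) :=
    (((tendsto_const_div_atTop_nhds_zero_nat e).const_add 1).const_mul 2).div
      (tendsto_one_div_atTop_nhds_zero_nat.const_sub 1) (by norm_num)
  norm_num at h
  refine h.congr' ?_
  filter_upwards [eventually_ge_atTop 2] with n hn
  have h1 : (1 : ℝ) < n := by exact_mod_cast hn
  have h2 : (n : ℝ) - 1 ≠ 0 := by linarith
  have h3 : (n : ℝ) ≠ 0 := by linarith
  rw [edgeDensity, card_edgeSet hx, Nat.cast_choose_two, Nat.cast_add, ← he]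
  field_simp

theorem tendsto_choose_typeCount {a : Fin K}
    (h : Tendsto (fun n : ℕ => typeCount a₀ x n a / n) atTop (𝓝 (π a))) :
    Tendsto (fun n : ℕ => ((typeVertices a₀ x n a).card.choose 2 : ℝ) / (n : ℝ) ^ 2) atTop
      (𝓝 (π a * π a / 2)) := by
  have h1 := (h.mul (h.sub tendsto_one_div_atTop_nhds_zero_nat)).div_const 2
  rw [sub_zero] at h1
  refine h1.congr' ?_
  filter_upwards [eventually_ge_atTop 1] with n hn
  have h0 : (n : ℝ) ≠ 0 := Nat.cast_ne_zero.2 (by omega)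
  rw [Nat.cast_choose_two, typeCount]
  field_simp

theorem ae_tendsto_homophily [Nonempty (Fin K × Vertex n₀)] (hπ : ∀ a, 0 < π a)
    (hπ_sum : ∑ a, π a = 1) (hκ : ∀ a b, 0 < κ a b) (hG₀ : G₀.Connected)
    (hη : η ∈ openSimplex K) (hcrit : ∀ j, π j / η j + phi π κ η j = 2)
    (hX : HasTransition μ X (stepSupport K n₀) (stepProb π κ G₀ a₀)) (a : Fin K) :
    ∀ᵐ ω ∂μ, Tendsto (fun n : ℕ => homophily G₀ a₀ (fun i => X i ω) n a) atTop
      (𝓝 (meanMatrix π κ η a a / π a)) := by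
  filter_upwards [ae_isValid hX, ae_tendsto_typeCount hκ hG₀ hX a,
    ae_tendsto_numEdges_self hπ hπ_sum hκ hG₀ hη hcrit hX a] with ω hx hc he
  have ha := hπ a
  -- The powers of `n` balance: edges are scaled by `n`, pairs of vertices by `n²`, and the density
  -- by `1 / n`.
  have h := he.div ((tendsto_choose_typeCount hc).mul (tendsto_mul_edgeDensity (G₀ := G₀) hx))
    (by positivity)
  have e : meanMatrix π κ η a a * π a / (π a * π a / 2 * 2) = meanMatrix π κ η a a / π a := by
    field_simp
  rw [e] at h
  refine h.congr' ?_
  filter_upwards [eventually_ge_atTop 1] with n hn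
  have h0 : (n : ℝ) ≠ 0 := Nat.cast_ne_zero.2 (by omega)
  rw [homophily, Pi.div_apply]
  field_simp

theorem ae_tendsto_heterophily [Nonempty (Fin K × Vertex n₀)] (hπ : ∀ a, 0 < π a)
    (hπ_sum : ∑ a, π a = 1) (hκ : ∀ a b, 0 < κ a b) (hG₀ : G₀.Connected)
    (hη : η ∈ openSimplex K) (hcrit : ∀ j, π j / η j + phi π κ η j = 2)
    (hX : HasTransition μ X (stepSupport K n₀) (stepProb π κ G₀ a₀)) {a b : Fin K}
    (hab : a ≠ b) :
    ∀ᵐ ω ∂μ, Tendsto (fun n : ℕ => heterophily G₀ a₀ (fun i => X i ω) n a b) atTop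
      (𝓝 ((1 / 2) * (meanMatrix π κ η b a / π a + meanMatrix π κ η a b / π b))) := by
  filter_upwards [ae_isValid hX, ae_tendsto_typeCount hκ hG₀ hX a,
    ae_tendsto_typeCount hκ hG₀ hX b,
    ae_tendsto_numEdges_ne hπ hπ_sum hκ hG₀ hη hcrit hX hab] with ω hx hca hcb he
  have ha := hπ a
  have hb := hπ b
  have h := he.div ((hca.mul hcb).mul (tendsto_mul_edgeDensity (G₀ := G₀) hx)) (by positivity)
  have e : (meanMatrix π κ η b a * π b + meanMatrix π κ η a b * π a) / (π a * π b * 2) =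
      (1 / 2) * (meanMatrix π κ η b a / π a + meanMatrix π κ η a b / π b) := by
    field_simp
  rw [e] at h
  refine h.congr' ?_
  filter_upwards [eventually_ge_atTop 1] with n hn
  have h0 : (n : ℝ) ≠ 0 := Nat.cast_ne_zero.2 (by omega)
  rw [heterophily, Pi.div_apply, typeCount, typeCount]
  field_simp

end Statistics

end AttributedPA

theorem theorem3p6 {K n₀ : ℕ} {Ω : Type*} [MeasurableSpace Ω]
    (μ : Measure Ω) [IsProbabilityMeasure μ]
    (π : Fin K → ℝ) (hπ : ∀ a, 0 < π a) (hπ_sum : ∑ a, π a = 1)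
    (κ : Fin K → Fin K → ℝ) (hκ : ∀ a b, 0 < κ a b)
    (G₀ : SimpleGraph (Fin n₀)) (hG₀ : G₀.Connected) (a₀ : Fin n₀ → Fin K)
    (X : ℕ → Ω → Fin K × AttributedPA.Vertex n₀)
    (hX : AttributedPA.IsModel μ π κ G₀ a₀ X) :
    (∃! η : Fin K → ℝ, AttributedPA.IsMinimizer π κ η) ∧
    ∀ η : Fin K → ℝ, AttributedPA.IsMinimizer π κ η →
      -- (a) degree distributions: the limit, that it is a pmf on `k ≥ 1`, and its tail
      (∀ a : Fin K,
        (∀ᵐ ω ∂μ, ∀ k : ℕ, 1 ≤ k →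
          Tendsto (fun n : ℕ => AttributedPA.empDegree G₀ a₀ (fun i => X i ω) n a k) atTop
            (𝓝 (AttributedPA.limitDegree (AttributedPA.phi π κ η a) k))) ∧
        HasSum (fun k : ℕ => AttributedPA.limitDegree (AttributedPA.phi π κ η a) (k + 1)) 1 ∧
        (fun k : ℕ => AttributedPA.limitDegree (AttributedPA.phi π κ η a) k) ~[atTop]
          (fun k : ℕ => (2 / AttributedPA.phi π κ η a) *
            Real.Gamma (1 + 2 / AttributedPA.phi π κ η a) *
            (k : ℝ) ^ (-(1 + 2 / AttributedPA.phi π κ η a)))) ∧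
      -- (b) homophily and heterophily statistics
      (∀ a : Fin K, ∀ᵐ ω ∂μ,
        Tendsto (fun n : ℕ => AttributedPA.homophily G₀ a₀ (fun i => X i ω) n a) atTop
          (𝓝 (AttributedPA.meanMatrix π κ η a a / π a))) ∧
      (∀ a b : Fin K, a ≠ b → ∀ᵐ ω ∂μ,
        Tendsto (fun n : ℕ => AttributedPA.heterophily G₀ a₀ (fun i => X i ω) n a b) atTop
          (𝓝 ((1 / 2) * (AttributedPA.meanMatrix π κ η b a / π a +
            AttributedPA.meanMatrix π κ η a b / π b)))) := by
  have hne := AttributedPA.nonempty_fin_of_sum_eq_one hπ_sum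
  obtain ⟨w⟩ := hG₀.nonempty
  have : Nonempty (Fin K × AttributedPA.Vertex n₀) := ⟨(hne.some, Sum.inl w)⟩
  have hT := hX.hasTransition hπ hπ_sum hκ hG₀
  refine ⟨AttributedPA.existsUnique_isMinimizer hπ hπ_sum hκ, fun η hmin => ?_⟩
  have hη := hmin.1
  have hcrit := hmin.critical hκ hπ_sum
  refine ⟨fun a => ?_, fun a => AttributedPA.ae_tendsto_homophily hπ hπ_sum hκ hG₀ hη hcrit hT a,
    fun a b hab => AttributedPA.ae_tendsto_heterophily hπ hπ_sum hκ hG₀ hη hcrit hT hab⟩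
  have hφ : 0 < AttributedPA.phi π κ η a := by
    rw [AttributedPA.phi_eq_rate]
    exact AttributedPA.rate_pos hπ hκ hη.1 a
  exact ⟨AttributedPA.ae_tendsto_empDegree hπ hπ_sum hκ hG₀ hη hcrit hT a,
    AttributedPA.hasSum_limitDegree hφ, AttributedPA.limitDegree_isEquivalent hφ⟩
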